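/- Let $T_n,U_n,V_n,W_n$ be the Chebyshev polynomials of the first, second, third and fourth kinds, i.e. the polynomials of degree $n$ with $$T_n(\cos\theta)=\cos n\theta,\quad U_n(\cos\theta)=\frac{\sin (n+1)\theta}{\sin\theta},\quad V_n(\cos\theta)=\frac{\cos(n+\frac12)\theta}{\cos\frac12\theta},\quad W_n(\cos\theta)=\frac{\sin(n+\frac12)\theta}{\sin\frac12\theta}.$$ For $\alpha\in\{T,U,V,W\}$ let $Q_n$ denote the polynomial of kind $\alpha$ and degree $n$, and put $f_{n,\alpha}(x)=Q_n(x)/Q_{n-1}(x)$. Let $n\ge 1$ (and $n\ge 2$ if $\alpha=T$), and let $P_\alpha(z)=\sum_{j=0}^{2n}p_jz^j$ be a real self-reciprocal polynomial of degree exactly $2n$ (so $p_j=p_{2n-j}$ and $p_{2n}\ne0$). Its class, its parameter $c_\alpha$ and the associated polynomial $R_{n,\alpha}$ are given as follows. * $\alpha=T$: $p_j=0$ for $n\le j\le 2n-2$, $p_{2n}p_{2n-1}\neq0$; $c_T=-p_{2n-1}/p_{2n}$; $R_{n,T}=p_{2n}T_n+p_{2n-1}T_{n-1}$. * $\alpha=U$: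 for $n\le j\le 2n$, $p_j=p_{2n}$ if $j$ is even and $p_j=p_{2n-1}$ if $j$ is odd, $p_{2n}p_{2n-1}\ne0$; $c_U=-p_{2n-1}/p_{2n}$; $R_{n,U}=\frac{p_{2n}}2U_n+\frac{p_{2n-1}}2U_{n-1}$. * $\alpha=V$: $p_j=(-1)^{j+1}p_{2n-1}$ for $n\le j\le 2n-1$, $p_{2n}\ne0$, $p_{2n}\ne-p_{2n-1}$; $c_V=-\left(\frac{p_{2n-1}}{p_{2n}}+1\right)$; $R_{n,V}=\frac{p_{2n}}2V_n+\frac{p_{2n}+p_{2n-1}}2V_{n-1}$. * $\alpha=W$: $p_j=p_{2n-1}$ for $n\le j\le 2n-1$, $p_{2n}\ne0$, $p_{2n}\neq p_{2n-1}$; $c_W=1-\frac{p_{2n-1}}{p_{2n}}$; $R_{n,W}=\frac{p_{2n}}2W_n+\frac{p_{2n-1}-p_{2n}}2W_{n-1}$. Let $S_\alpha(z)=s\,(z+1)P_\alpha(z)$ with an arbitrary real $s\neq0$. Then $f_{n,\alpha}(-1)<0<f_{n,\alpha}(1)$, and the following hold (zeros are complex zeros). 1. If $c_\alpha\ne f_{n,\alpha}(1)$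 and $c_\alpha\neq f_{n,\alpha}(-1)$, all zeros of $P_\alpha$ and of $S_\alpha$ are simple. In every case at most two zeros of $P_\alpha$, and at most two zeros of $S_\alpha$, counted with multiplicity, do not lie on the unit circle. 2. If $c_\alpha=f_{n,\alpha}(1)$, then $z=1$ is a zero of multiplicity exactly two of $P_\alpha$ and of $S_\alpha$. If $c_\alpha=f_{n,\alpha}(-1)$, then $z=-1$ is a zero of multiplicity exactly two of $P_\alpha$ and exactly three of $S_\alpha$. In both cases all other zeros of $P_\alpha$ and of $S_\alpha$ are simple. 3. If $c_\alpha<f_{n,\alpha}(-1)$, there is a real $r<-1$ such that the zeros of $P_\alpha$, and likewise of $S_\alpha$, off the unit circle are exactly $r\in(-\infty,-1)$ and $1/r\in(-1,0)$; $P_\alpha$ has exactly $2n-2$ and $S_\alpha$ exactly $2n-1$ distinct zeros on the unit circle. 4. If $c_\alpha>f_{n,\alpha}(1)$, there is a real $r>1$ such that the zeros of $P_\alpha$, and likewise of $S_\alpha$, off the unit circle are exactly $r\in(1,\infty)$ and $1/r\in(0,1)$; $P_\alpha$ has exactly $2n-2$ and $S_\alpha$ exactly $2n-1$ distinct zeros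 on the unit circle. 5. If $f_{n,\alpha}(-1)<c_\alpha<f_{n,\alpha}(1)$, all zeros of $P_\alpha$ and of $S_\alpha$ lie on the unit circle. The zeros of $R_{n,\alpha}$ can be labelled $x_{1},\dots,x_{n}\in(-1,1)$ so that, with $\theta_{k}=\arccos x_{k}$, one has $0<\theta_1<\theta_2<\dots<\theta_n<\pi$; the zeros of $P_\alpha$ are exactly the numbers $e^{\pm i\theta_k}$, $k=1,\dots,n$, and those of $S_\alpha$ are exactly these numbers together with $e^{i\theta_{n+1}}=-1$, $\theta_{n+1}=\pi$. For fixed $\alpha$ and $n$, the $x_k$ and $\theta_k$ ($1\le k\le n$) depend only on $c_\alpha$, and each $\theta_k$ is a strictly decreasing function of $c_\alpha\in(f_{n,\alpha}(-1),f_{n,\alpha}(1))$. -/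

import Mathlib

open Polynomial

/-- The four kinds of Chebyshev polynomials. -/
inductive ChebKind where
  | T
  | U
  | V
  | W

/-- The Chebyshev polynomial of degree `n` of each kind. The third and fourth kinds are
`V n = U n - U (n - 1)` and `W n = U n + U (n - 1)` (with `U (-1) = 0`); their trigonometric
characterisations are `ChebKind.eval_V_cos` and `ChebKind.eval_W_cos` below. -/
noncomputable def ChebKind.poly : ChebKind → ℕ → ℝ[X]
  | .T, n => Chebyshev.T ℝ n
  | .U, n => Chebyshev.U ℝ n
  | .V, n => Chebyshev.U ℝ n - Chebyshev.U ℝ ((n : ℤ) - 1)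
  | .W, n => Chebyshev.U ℝ n + Chebyshev.U ℝ ((n : ℤ) - 1)

theorem ChebKind.eval_T_cos (n : ℕ) (θ : ℝ) :
    (ChebKind.T.poly n).eval (Real.cos θ) = Real.cos (n * θ) := by
  simp [ChebKind.poly]

theorem ChebKind.eval_U_cos (n : ℕ) (θ : ℝ) :
    (ChebKind.U.poly n).eval (Real.cos θ) * Real.sin θ = Real.sin ((n + 1) * θ) := by
  simp [ChebKind.poly]

theorem ChebKind.eval_V_cos (n : ℕ) (θ : ℝ) (h : Real.sin θ ≠ 0) :
    (ChebKind.V.poly n).eval (Real.cos θ) * Real.cos (θ / 2) = Real.cos ((n + 1 / 2) * θ) := by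
  have h1 := Polynomial.Chebyshev.U_real_cos θ n
  have h2 := Polynomial.Chebyshev.U_real_cos θ ((n : ℤ) - 1)
  have hs : Real.sin θ = 2 * Real.sin (θ / 2) * Real.cos (θ / 2) := by
    rw [← Real.sin_two_mul]; congr 1; ring
  have e1 : Real.sin ((n + 1) * θ) = Real.sin ((n + 1 / 2) * θ + θ / 2) := by congr 1; ring
  have e2 : Real.sin (n * θ) = Real.sin ((n + 1 / 2) * θ - θ / 2) := by congr 1; ring
  push_cast at h1 h2
  rw [sub_add_cancel, e2, Real.sin_sub] at h2
  rw [e1, Real.sin_add] at h1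
  have h0 : Real.sin (θ / 2) ≠ 0 := by
    intro h0; apply h; rw [hs, h0]; ring
  simp only [ChebKind.poly, eval_sub]
  rw [hs] at h1 h2
  apply mul_left_cancel₀ (mul_ne_zero two_ne_zero h0)
  linear_combination h1 - h2

theorem ChebKind.eval_W_cos (n : ℕ) (θ : ℝ) (h : Real.sin θ ≠ 0) :
    (ChebKind.W.poly n).eval (Real.cos θ) * Real.sin (θ / 2) = Real.sin ((n + 1 / 2) * θ) := by
  have h1 := Polynomial.Chebyshev.U_real_cos θ n
  have h2 := Polynomial.Chebyshev.U_real_cos θ ((n : ℤ) - 1)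
  have hs : Real.sin θ = 2 * Real.sin (θ / 2) * Real.cos (θ / 2) := by
    rw [← Real.sin_two_mul]; congr 1; ring
  have e1 : Real.sin ((n + 1) * θ) = Real.sin ((n + 1 / 2) * θ + θ / 2) := by congr 1; ring
  have e2 : Real.sin (n * θ) = Real.sin ((n + 1 / 2) * θ - θ / 2) := by congr 1; ring
  push_cast at h1 h2
  rw [sub_add_cancel, e2, Real.sin_sub] at h2
  rw [e1, Real.sin_add] at h1
  have h0 : Real.cos (θ / 2) ≠ 0 := by
    intro h0; apply h; rw [hs, h0]; ring
  simp only [ChebKind.poly, eval_add]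
  rw [hs] at h1 h2
  apply mul_left_cancel₀ (mul_ne_zero two_ne_zero h0)
  linear_combination h1 + h2

/-- The quotient `f_{n,α}(x) = Q_n(x) / Q_{n-1}(x)`, where `Q` is the Chebyshev family of kind
`α`; used for `n ≥ 1` and at `x = 1`, `x = -1`, where the denominator does not vanish. -/
noncomputable def ChebKind.ratio (α : ChebKind) (n : ℕ) (x : ℝ) : ℝ :=
  (α.poly n).eval x / (α.poly (n - 1)).eval x

/-- The conditions on the coefficients `p_n, …, p_{2n}` that single out the classes. -/
def ChebKind.CoeffCond (n : ℕ) (P : ℝ[X]) : ChebKind → Prop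
  | .T => 2 ≤ n ∧ (∀ j, n ≤ j → j ≤ 2 * n - 2 → P.coeff j = 0) ∧
      P.coeff (2 * n) * P.coeff (2 * n - 1) ≠ 0
  | .U => (∀ j, n ≤ j → j ≤ 2 * n → Even j → P.coeff j = P.coeff (2 * n)) ∧
      (∀ j, n ≤ j → j ≤ 2 * n → Odd j → P.coeff j = P.coeff (2 * n - 1)) ∧
      P.coeff (2 * n) ≠ 0 ∧ P.coeff (2 * n - 1) ≠ 0
  | .V => (∀ j, n ≤ j → j ≤ 2 * n - 1 → P.coeff j = (-1) ^ (j + 1) * P.coeff (2 * n - 1)) ∧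
      P.coeff (2 * n) ≠ 0 ∧ P.coeff (2 * n) ≠ -P.coeff (2 * n - 1)
  | .W => (∀ j, n ≤ j → j ≤ 2 * n - 1 → P.coeff j = P.coeff (2 * n - 1)) ∧
      P.coeff (2 * n) ≠ 0 ∧ P.coeff (2 * n) ≠ P.coeff (2 * n - 1)

/-- `P` is one of the real self-reciprocal polynomials `P_α` of degree `2n`.
`P.reverse` is `z ^ (deg P) * P (1 / z)`. -/
structure ChebKind.IsP (α : ChebKind) (n : ℕ) (P : ℝ[X]) : Prop where
  natDegree_eq : P.natDegree = 2 * n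
  selfReciprocal : P.reverse = P
  coeffCond : ChebKind.CoeffCond n P α

/-- The odd-degree polynomial `S_α(z) = s (z + 1) P_α(z)`. -/
noncomputable def oddVersion (s : ℝ) (P : ℝ[X]) : ℝ[X] := C s * ((X + 1) * P)

/-- The parameter `c_α`. -/
noncomputable def ChebKind.param (n : ℕ) (P : ℝ[X]) : ChebKind → ℝ
  | .T => -(P.coeff (2 * n - 1) / P.coeff (2 * n))
  | .U => -(P.coeff (2 * n - 1) / P.coeff (2 * n))
  | .V => -(P.coeff (2 * n - 1) / P.coeff (2 * n) + 1)
  | .W => 1 - P.coeff (2 * n - 1) / P.coeff (2 * n)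

/-- The Chebyshev quasi-orthogonal polynomial `R_{n,α} = c₀ Q_n + c₁ Q_{n-1}` attached to `P_α`,
so that `P_α(z) = 2 z ^ n R_{n,α}((z + 1 / z) / 2)`. -/
noncomputable def ChebKind.quasi (n : ℕ) (P : ℝ[X]) : ChebKind → ℝ[X]
  | .T => C (P.coeff (2 * n)) * ChebKind.T.poly n +
      C (P.coeff (2 * n - 1)) * ChebKind.T.poly (n - 1)
  | .U => C (P.coeff (2 * n) / 2) * ChebKind.U.poly n +
      C (P.coeff (2 * n - 1) / 2) * ChebKind.U.poly (n - 1)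
  | .V => C (P.coeff (2 * n) / 2) * ChebKind.V.poly n +
      C ((P.coeff (2 * n) + P.coeff (2 * n - 1)) / 2) * ChebKind.V.poly (n - 1)
  | .W => C (P.coeff (2 * n) / 2) * ChebKind.W.poly n +
      C ((P.coeff (2 * n - 1) - P.coeff (2 * n)) / 2) * ChebKind.W.poly (n - 1)

/-- Multiplicity of the complex number `z` as a zero of the real polynomial `P`. -/
noncomputable def zeroMult (P : ℝ[X]) (z : ℂ) : ℕ :=
  (P.map (algebraMap ℝ ℂ)).rootMultiplicity z

/-- Number of complex zeros off the unit circle, counted with multiplicity. -/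
noncomputable def offCircleCount (P : ℝ[X]) : ℕ :=
  ((P.aroots ℂ).filter (fun z => ‖z‖ ≠ 1)).card

/-! Write `A = Q_n`, `B = Q_{n-1}`. The substitution `x = (z + 1/z)/2` gives `P(z) = 2 z^n R(x)`,
where `R` is a nonzero multiple of `A - c B` and `c` is the parameter of `P`. So the zeros of `P`
are governed by those of a real pencil of degree `n`.

For `x = cos θ`, a common positive weight turns `A` and `B` into sines whose phases differ by `θ`
(`ChebKind.exists_weight`). Hence the zeros of `B` cut `(0, π)` into `n` intervals, and `A` has sign
`(-1)^k` at the `k`-th node. At interior nodes `B = 0`, so `A - c B` keeps this sign for every `c`;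
only the signs at `x = 1` and `x = -1` depend on `c`, through its comparison with `A/B` there. The
intermediate value theorem gives a zero in every interval, except that `c ≥ A(1)/B(1)` moves the
zero of the first interval into `[1, ∞)`, and `c ≤ A(-1)/B(-1)` moves that of the last into `(-∞,
-1]`. These `n` distinct zeros exhaust the degree.

Consequently `P` is a constant times the product of the quadratics `z^2 - 2 x_k z + 1`
(`ChebKind.IsP.eq_prod`). Such a quadratic has a conjugate pair on the unit circle if `|x_k| < 1`,
the double zero `x_k` if `x_k = ±1`, and a real reciprocal pair if `|x_k| > 1`; distinct `x_k` share
no zeros. The factor `z + 1` only adds one zero at `-1`.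

Monotonicity (`Interlacing.angle_lt`): raising `c` makes the pencil negative, relative to the left
node, at the old angle, so the unique zero in that interval has moved left. -/

/-- Sign conditions expressing that the zeros of `A` and `B` interlace in `(-1, 1)`. The zeros of
`B` are `cos (t k)` for `0 < k < n`, and `t 0 = 0`, `t n = π`. -/
structure Interlacing (A B : ℝ[X]) (n : ℕ) (t : ℕ → ℝ) : Prop where
  pos : 1 ≤ n
  natDegree_le : A.natDegree ≤ n
  coeff_pos : 0 < A.coeff n
  natDegree_lt : B.natDegree < n
  t_zero : t 0 = 0
  t_last : t n = Real.pi
  t_lt : ∀ k < n, t k < t (k + 1)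
  sign_left : ∀ k ≤ n, 0 < (-1) ^ k * A.eval (Real.cos (t k))
  root_right : ∀ k, 0 < k → k < n → B.eval (Real.cos (t k)) = 0
  right_one : 0 < B.eval 1
  right_neg_one : 0 < (-1) ^ (n - 1) * B.eval (-1)
  sign_right : ∀ k < n, ∀ θ, t k < θ → θ < t (k + 1) → 0 < (-1) ^ k * B.eval (Real.cos θ)

/-! ### Real zeros of the pencil `A - c B` for an interlacing pair -/

namespace Interlacing

variable {A B : ℝ[X]} {n : ℕ} {t : ℕ → ℝ}

theorem t_le (h : Interlacing A B n t) {j k : ℕ} (hjk : j ≤ k) (hk : k ≤ n) : t j ≤ t k := by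
  induction k, hjk using Nat.le_induction with
  | base => exact le_rfl
  | succ k _ ih => exact (ih (by omega)).trans (h.t_lt k (by omega)).le

theorem t_nonneg (h : Interlacing A B n t) {k : ℕ} (hk : k ≤ n) : 0 ≤ t k :=
  h.t_zero ▸ h.t_le (Nat.zero_le k) hk

theorem t_le_pi (h : Interlacing A B n t) {k : ℕ} (hk : k ≤ n) : t k ≤ Real.pi :=
  h.t_last ▸ h.t_le hk le_rfl

theorem ratio_one_pos (h : Interlacing A B n t) : 0 < A.eval 1 / B.eval 1 := by
  have h1 := h.sign_left 0 (Nat.zero_le n)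
  rw [h.t_zero, Real.cos_zero] at h1
  exact div_pos (by simpa using h1) h.right_one

theorem left_neg_one (h : Interlacing A B n t) : 0 < (-1) ^ n * A.eval (-1) := by
  simpa [h.t_last] using h.sign_left n le_rfl

theorem neg_one_pow_eq (h : Interlacing A B n t) : (-1 : ℝ) ^ n = -(-1) ^ (n - 1) := by
  obtain ⟨m, rfl⟩ : ∃ m, n = m + 1 := ⟨n - 1, by have := h.pos; omega⟩
  simp [pow_succ]

theorem ratio_neg_one_eq (h : Interlacing A B n t) :
    A.eval (-1) / B.eval (-1) = -(((-1) ^ n * A.eval (-1)) / ((-1) ^ (n - 1) * B.eval (-1))) := by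
  have h0 : (-1 : ℝ) ^ (n - 1) ≠ 0 := by simp
  rw [h.neg_one_pow_eq, neg_mul, neg_div, neg_neg, mul_div_mul_left _ _ h0]

theorem ratio_neg_one_neg (h : Interlacing A B n t) : A.eval (-1) / B.eval (-1) < 0 := by
  rw [h.ratio_neg_one_eq]
  exact neg_neg_of_pos (div_pos h.left_neg_one h.right_neg_one)

theorem eval_one_eq (h : Interlacing A B n t) (c : ℝ) :
    (A - C c * B).eval 1 = B.eval 1 * (A.eval 1 / B.eval 1 - c) := by
  have := h.right_one.ne'
  simp only [eval_sub, eval_mul, eval_C]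
  field_simp

theorem eval_neg_one_eq (h : Interlacing A B n t) (c : ℝ) :
    (-1) ^ n * (A - C c * B).eval (-1) =
      ((-1) ^ (n - 1) * B.eval (-1)) * (c - A.eval (-1) / B.eval (-1)) := by
  have : B.eval (-1) ≠ 0 := by
    intro h0
    simpa [h0] using h.right_neg_one
  simp only [eval_sub, eval_mul, eval_C, h.neg_one_pow_eq]
  field_simp
  ring

/-- Since `B` vanishes at the interior nodes, `c` affects the sign only at the two end nodes; hence
the two conditional hypotheses. -/
theorem sign_sub (h : Interlacing A B n t) {c : ℝ} {k : ℕ} (hk : k ≤ n)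
    (h0 : k = 0 → c < A.eval 1 / B.eval 1) (h1 : k = n → A.eval (-1) / B.eval (-1) < c) :
    0 < (-1) ^ k * (A - C c * B).eval (Real.cos (t k)) := by
  rcases Nat.eq_zero_or_pos k with rfl | hk0
  · rw [h.t_zero, Real.cos_zero, h.eval_one_eq, pow_zero, one_mul]
    exact mul_pos h.right_one (sub_pos.2 (h0 rfl))
  rcases hk.eq_or_lt with rfl | hkn
  · rw [h.t_last, Real.cos_pi, h.eval_neg_one_eq]
    exact mul_pos h.right_neg_one (sub_pos.2 (h1 rfl))
  · simpa [h.root_right k hk0 hkn] using h.sign_left k hk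

theorem exists_root_of_sign {R : ℝ[X]} {k : ℕ} {a b : ℝ} (hab : a ≤ b)
    (ha : 0 < (-1) ^ k * R.eval (Real.cos a)) (hb : (-1) ^ k * R.eval (Real.cos b) < 0) :
    ∃ θ ∈ Set.Ioo a b, R.eval (Real.cos θ) = 0 := by
  have hcont : ContinuousOn (fun θ => (-1) ^ k * R.eval (Real.cos θ)) (Set.Icc a b) := by
    fun_prop
  obtain ⟨θ, hθ, h0⟩ := intermediate_value_Ioo' hab hcont (Set.mem_Ioo.2 ⟨hb, ha⟩)
  exact ⟨θ, hθ, by simpa using h0⟩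

theorem exists_root (h : Interlacing A B n t) {c : ℝ} {k : ℕ} (hk : k < n)
    (h0 : k = 0 → c < A.eval 1 / B.eval 1) (h1 : k + 1 = n → A.eval (-1) / B.eval (-1) < c) :
    ∃ θ ∈ Set.Ioo (t k) (t (k + 1)), (A - C c * B).eval (Real.cos θ) = 0 := by
  refine exists_root_of_sign (k := k) (h.t_lt k hk).le
    (h.sign_sub hk.le h0 (fun hkn => absurd hkn hk.ne)) ?_
  have := h.sign_sub (c := c) hk (fun hk0 => absurd hk0 (Nat.succ_ne_zero k)) h1
  rw [pow_succ] at this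
  linarith

theorem natDegree_sub_le (h : Interlacing A B n t) (c : ℝ) : (A - C c * B).natDegree ≤ n :=
  (Polynomial.natDegree_sub_le _ _).trans
    (max_le h.natDegree_le ((natDegree_C_mul_le _ _).trans h.natDegree_lt.le))

theorem coeff_sub_pos (h : Interlacing A B n t) (c : ℝ) : 0 < (A - C c * B).coeff n := by
  simpa [coeff_eq_zero_of_natDegree_lt h.natDegree_lt] using h.coeff_pos

theorem natDegree_sub (h : Interlacing A B n t) (c : ℝ) : (A - C c * B).natDegree = n :=
  natDegree_eq_of_le_of_coeff_ne_zero (h.natDegree_sub_le c) (h.coeff_sub_pos c).ne'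

theorem leadingCoeff_sub_pos (h : Interlacing A B n t) (c : ℝ) :
    0 < (A - C c * B).leadingCoeff := by
  rw [leadingCoeff, h.natDegree_sub]
  exact h.coeff_sub_pos c

theorem exists_root_gt {R : ℝ[X]} {a : ℝ} (hdeg : 0 < R.natDegree) (hlead : 0 < R.leadingCoeff)
    (ha : R.eval a < 0) : ∃ e, a < e ∧ R.eval e = 0 := by
  have ht := R.tendsto_atTop_of_leadingCoeff_nonneg (natDegree_pos_iff_degree_pos.1 hdeg) hlead.le
  obtain ⟨b, hb, hab⟩ := ((ht.eventually_gt_atTop 0).and (Filter.eventually_gt_atTop a)).exists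
  obtain ⟨e, he, h0⟩ := intermediate_value_Ioo hab.le R.continuous.continuousOn
    (Set.mem_Ioo.2 ⟨ha, hb⟩)
  exact ⟨e, he.1, h0⟩

theorem exists_root_gt_one (h : Interlacing A B n t) {c : ℝ} (hc : A.eval 1 / B.eval 1 < c) :
    ∃ e, 1 < e ∧ (A - C c * B).eval e = 0 := by
  refine exists_root_gt (by rw [h.natDegree_sub]; exact h.pos) (h.leadingCoeff_sub_pos c) ?_
  rw [h.eval_one_eq]
  exact mul_neg_of_pos_of_neg h.right_one (sub_neg.2 hc)

/-- Reflecting `x ↦ -x` reduces this to the growth argument at `+∞`; the factor `(-1)^n` keeps the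
leading coefficient positive. -/
theorem exists_root_lt_neg_one (h : Interlacing A B n t) {c : ℝ}
    (hc : c < A.eval (-1) / B.eval (-1)) :
    ∃ e, e < -1 ∧ (A - C c * B).eval e = 0 := by
  have hu : ((-1 : ℝ) ^ n) ≠ 0 := by simp
  have hX : (-X : ℝ[X]).natDegree = 1 := by simp
  have hdeg : (C ((-1 : ℝ) ^ n) * (A - C c * B).comp (-X)).natDegree = n := by
    rw [natDegree_C_mul hu, natDegree_comp, h.natDegree_sub, hX, mul_one]
  have hlead : 0 < (C ((-1 : ℝ) ^ n) * (A - C c * B).comp (-X)).leadingCoeff := by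
    rw [leadingCoeff_mul, leadingCoeff_C, leadingCoeff_comp (by rw [hX]; exact one_ne_zero),
      h.natDegree_sub, leadingCoeff_neg, leadingCoeff_X, mul_left_comm, ← mul_pow]
    simpa using h.leadingCoeff_sub_pos c
  obtain ⟨e, he, h0⟩ := exists_root_gt (a := 1) (by rw [hdeg]; exact h.pos) hlead (by
    rw [eval_mul, eval_C, eval_comp, eval_neg, eval_X, h.eval_neg_one_eq]
    exact mul_neg_of_pos_of_neg h.right_neg_one (sub_neg.2 hc))
  refine ⟨-e, by linarith, ?_⟩
  rw [eval_mul, eval_C, eval_comp, eval_neg, eval_X] at h0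
  exact (mul_eq_zero.1 h0).resolve_left hu

theorem cos_mem_Ioo {θ : ℝ} (h0 : 0 < θ) (h1 : θ < Real.pi) : Real.cos θ ∈ Set.Ioo (-1 : ℝ) 1 := by
  constructor
  · rw [← Real.cos_pi]
    exact Real.cos_lt_cos_of_nonneg_of_le_pi h0.le le_rfl h1
  · rw [← Real.cos_zero]
    exact Real.cos_lt_cos_of_nonneg_of_le_pi le_rfl h1.le h0

theorem mem_Ioo_pi (h : Interlacing A B n t) {k : ℕ} (hk : k < n) {θ : ℝ}
    (hθ : θ ∈ Set.Ioo (t k) (t (k + 1))) : 0 < θ ∧ θ < Real.pi :=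
  ⟨(h.t_nonneg hk.le).trans_lt hθ.1, hθ.2.trans_le (h.t_le_pi hk)⟩

theorem lt_of_mem_Ioo (h : Interlacing A B n t) {j k : ℕ} (hjk : j < k) (hk : k < n) {θ φ : ℝ}
    (hθ : θ ∈ Set.Ioo (t j) (t (j + 1))) (hφ : φ ∈ Set.Ioo (t k) (t (k + 1))) : θ < φ :=
  hθ.2.trans_le ((h.t_le hjk hk.le).trans hφ.1.le)

theorem eq_of_mem_Ioo (h : Interlacing A B n t) {j k : ℕ} (hj : j < n) (hk : k < n) {θ : ℝ}
    (hθ : θ ∈ Set.Ioo (t j) (t (j + 1))) (hφ : θ ∈ Set.Ioo (t k) (t (k + 1))) : j = k := by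
  rcases lt_trichotomy j k with hjk | rfl | hjk
  · exact absurd (h.lt_of_mem_Ioo hjk hk hθ hφ) (lt_irrefl _)
  · rfl
  · exact absurd (h.lt_of_mem_Ioo hjk hj hφ hθ) (lt_irrefl _)

theorem cos_injective (h : Interlacing A B n t) {j k : ℕ} (hj : j < n) (hk : k < n) {θ φ : ℝ}
    (hθ : θ ∈ Set.Ioo (t j) (t (j + 1))) (hφ : φ ∈ Set.Ioo (t k) (t (k + 1)))
    (hcos : Real.cos θ = Real.cos φ) : j = k := by
  have h1 := h.mem_Ioo_pi hj hθ
  have h2 := h.mem_Ioo_pi hk hφ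
  have : θ = φ := Real.injOn_cos ⟨h1.1.le, h1.2.le⟩ ⟨h2.1.le, h2.2.le⟩ hcos
  subst this
  exact h.eq_of_mem_Ioo hj hk hθ hφ

/-- The zero `e` outside `(-1, 1)` replaces the one missing from interval `k₀`, so that `n` distinct
zeros are again available. -/
theorem exists_roots_except (h : Interlacing A B n t) {c e : ℝ} (k₀ : Fin n)
    (he : e ∉ Set.Ioo (-1 : ℝ) 1) (hroot : (A - C c * B).eval e = 0)
    (hroots : ∀ k : Fin n, k ≠ k₀ →
      ∃ θ ∈ Set.Ioo (t k) (t (k + 1)), (A - C c * B).eval (Real.cos θ) = 0) :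
    ∃ x : Fin n → ℝ, Function.Injective x ∧ (∀ k, (A - C c * B).eval (x k) = 0) ∧
      x k₀ = e ∧ ∀ k, k ≠ k₀ → x k ∈ Set.Ioo (-1 : ℝ) 1 := by
  classical
  choose! θ hθ h0 using hroots
  have hmem : ∀ k, k ≠ k₀ → Real.cos (θ k) ∈ Set.Ioo (-1 : ℝ) 1 := fun k hk =>
    cos_mem_Ioo (h.mem_Ioo_pi k.2 (hθ k hk)).1 (h.mem_Ioo_pi k.2 (hθ k hk)).2
  refine ⟨fun k => if k = k₀ then e else Real.cos (θ k), ?_, ?_, by simp, ?_⟩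
  · intro j k hjk
    dsimp only at hjk
    split_ifs at hjk with hj hk hk
    · rw [hj, hk]
    · exact absurd (hjk ▸ hmem k hk) he
    · exact absurd (hjk ▸ hmem j hj) he
    · exact Fin.ext (h.cos_injective j.2 k.2 (hθ j hj) (hθ k hk) hjk)
  · intro k
    dsimp only
    split_ifs with hk
    · exact hroot
    · exact h0 k hk
  · intro k hk
    simpa [hk] using hmem k hk

theorem exists_roots_of_ge (h : Interlacing A B n t) {c : ℝ} (hc : A.eval 1 / B.eval 1 ≤ c) :
    ∃ x : Fin n → ℝ, Function.Injective x ∧ (∀ k, (A - C c * B).eval (x k) = 0) ∧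
      ∃ k₀, (∀ k, k ≠ k₀ → x k ∈ Set.Ioo (-1 : ℝ) 1) ∧ (c = A.eval 1 / B.eval 1 → x k₀ = 1) ∧
        (A.eval 1 / B.eval 1 < c → 1 < x k₀) := by
  obtain ⟨e, he1, he2, he0⟩ : ∃ e, (c = A.eval 1 / B.eval 1 → e = 1) ∧
      (A.eval 1 / B.eval 1 < c → 1 < e) ∧ (A - C c * B).eval e = 0 := by
    rcases hc.eq_or_lt with heq | hlt
    · exact ⟨1, fun _ => rfl, fun hlt => absurd heq hlt.ne, by simp [h.eval_one_eq, heq]⟩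
    · obtain ⟨e, he, h0⟩ := h.exists_root_gt_one hlt
      exact ⟨e, fun heq => absurd heq hlt.ne', fun _ => he, h0⟩
  have he : e ∉ Set.Ioo (-1 : ℝ) 1 := by
    rcases hc.eq_or_lt with heq | hlt
    · simp [he1 heq.symm]
    · exact fun hmem => absurd hmem.2 (he2 hlt).not_gt
  -- Only the first interval loses its sign change: `A(-1)/B(-1) < 0 < A(1)/B(1) ≤ c` keeps the sign
  -- at `-1`.
  obtain ⟨x, hx, h0, hk₀, hk⟩ := h.exists_roots_except ⟨0, h.pos⟩ he he0 (fun k hk =>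
    h.exists_root k.2 (fun hk0 => absurd (Fin.ext hk0) hk)
      (fun _ => h.ratio_neg_one_neg.trans (h.ratio_one_pos.trans_le hc)))
  exact ⟨x, hx, h0, ⟨0, h.pos⟩, hk, fun heq => hk₀.trans (he1 heq), fun hlt => hk₀ ▸ he2 hlt⟩

theorem exists_roots_of_le (h : Interlacing A B n t) {c : ℝ}
    (hc : c ≤ A.eval (-1) / B.eval (-1)) :
    ∃ x : Fin n → ℝ, Function.Injective x ∧ (∀ k, (A - C c * B).eval (x k) = 0) ∧
      ∃ k₀, (∀ k, k ≠ k₀ → x k ∈ Set.Ioo (-1 : ℝ) 1) ∧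
        (c = A.eval (-1) / B.eval (-1) → x k₀ = -1) ∧
        (c < A.eval (-1) / B.eval (-1) → x k₀ < -1) := by
  obtain ⟨e, he1, he2, he0⟩ : ∃ e, (c = A.eval (-1) / B.eval (-1) → e = -1) ∧
      (c < A.eval (-1) / B.eval (-1) → e < -1) ∧ (A - C c * B).eval e = 0 := by
    rcases hc.eq_or_lt with heq | hlt
    · refine ⟨-1, fun _ => rfl, fun hlt => absurd heq hlt.ne, ?_⟩
      have := h.eval_neg_one_eq c
      rw [heq, sub_self, mul_zero] at this
      rw [heq]
      exact (mul_eq_zero.1 this).resolve_left (by simp)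
    · obtain ⟨e, he, h0⟩ := h.exists_root_lt_neg_one hlt
      exact ⟨e, fun heq => absurd heq hlt.ne, fun _ => he, h0⟩
  have he : e ∉ Set.Ioo (-1 : ℝ) 1 := by
    rcases hc.eq_or_lt with heq | hlt
    · simp [he1 heq]
    · exact fun hmem => absurd hmem.1 (he2 hlt).not_gt
  have hn := h.pos
  -- Here the zero that escapes is that of the last interval, the one ending at `θ = π`.
  obtain ⟨x, hx, h0, hk₀, hk⟩ := h.exists_roots_except ⟨n - 1, by omega⟩ he he0 (fun k hk =>
    h.exists_root k.2 (fun _ => (hc.trans_lt h.ratio_neg_one_neg).trans h.ratio_one_pos)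
      (fun hk1 => absurd (Fin.ext (by simp; omega)) hk))
  exact ⟨x, hx, h0, ⟨n - 1, by omega⟩, hk, fun heq => hk₀.trans (he1 heq), fun hlt => hk₀ ▸ he2 hlt⟩

/-- A polynomial of degree at most `n` with `n` distinct zeros splits. -/
theorem eq_C_mul_prod {R : ℝ[X]} (hdeg : R.natDegree ≤ n) {x : Fin n → ℝ}
    (hx : Function.Injective x) (h0 : ∀ k, R.eval (x k) = 0) :
    R = C (R.coeff n) * ∏ k, (X - C (x k)) := by
  have hmonic : (∏ k, (X - C (x k))).Monic := monic_prod_X_sub_C _ _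
  have hnat : (∏ k, (X - C (x k))).natDegree = n := by
    simp [natDegree_prod_of_monic _ _ (fun k _ => monic_X_sub_C (x k))]
  have hcoeff : (∏ k, (X - C (x k))).coeff n = 1 := by
    simpa [Monic, leadingCoeff, hnat] using hmonic
  have hle : (C (R.coeff n) * ∏ k, (X - C (x k))).natDegree ≤ n :=
    (natDegree_C_mul_le _ _).trans hnat.le
  by_contra hne
  have hsub : R - C (R.coeff n) * ∏ k, (X - C (x k)) ≠ 0 := sub_ne_zero.2 hne
  have hlt : (R - C (R.coeff n) * ∏ k, (X - C (x k))).degree < n := by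
    refine (degree_lt_iff_coeff_zero _ _).2 fun m hm => ?_
    rcases hm.eq_or_lt with rfl | hm
    · simp [hcoeff]
    · exact coeff_eq_zero_of_natDegree_lt
        (((Polynomial.natDegree_sub_le _ _).trans (max_le hdeg hle)).trans_lt hm)
  refine hne (eq_of_degree_sub_lt_of_eval_index_eq Finset.univ hx.injOn (by simpa using hlt)
    fun k _ => ?_)
  rw [h0, eval_mul, eval_prod, Finset.prod_eq_zero (Finset.mem_univ k) (by simp), mul_zero]

/-- The angles of the zeros of `A - c B` when all of them lie in `(-1, 1)`. -/
theorem exists_angles (h : Interlacing A B n t) : ∃ θ : ℝ → Fin n → ℝ,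
    (∀ c ∈ Set.Ioo (A.eval (-1) / B.eval (-1)) (A.eval 1 / B.eval 1), ∀ k : Fin n,
      θ c k ∈ Set.Ioo (t k) (t (k + 1)) ∧ (A - C c * B).eval (Real.cos (θ c k)) = 0) ∧
    (∀ c k, 0 ≤ θ c k ∧ θ c k ≤ Real.pi) := by
  have hex : ∀ c ∈ Set.Ioo (A.eval (-1) / B.eval (-1)) (A.eval 1 / B.eval 1), ∀ k : Fin n,
      ∃ θ ∈ Set.Ioo (t k) (t (k + 1)), (A - C c * B).eval (Real.cos θ) = 0 := fun c hc k =>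
    h.exists_root k.2 (fun _ => hc.2) (fun _ => hc.1)
  have hall : ∀ c, ∀ k : Fin n, ∃ θ : ℝ,
      (c ∈ Set.Ioo (A.eval (-1) / B.eval (-1)) (A.eval 1 / B.eval 1) →
        θ ∈ Set.Ioo (t k) (t (k + 1)) ∧ (A - C c * B).eval (Real.cos θ) = 0) ∧
      0 ≤ θ ∧ θ ≤ Real.pi := by
    intro c k
    by_cases hc : c ∈ Set.Ioo (A.eval (-1) / B.eval (-1)) (A.eval 1 / B.eval 1)
    · obtain ⟨θ, hθ, h0⟩ := hex c hc k
      exact ⟨θ, fun _ => ⟨hθ, h0⟩, (h.mem_Ioo_pi k.2 hθ).1.le, (h.mem_Ioo_pi k.2 hθ).2.le⟩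
    -- The value `0` is a default; lying in `[0, π]`, it keeps `arccos (cos θ) = θ` valid for every
    -- real `c`.
    · exact ⟨0, fun h' => absurd h' hc, le_rfl, Real.pi_pos.le⟩
  choose θ hθ using hall
  exact ⟨θ, fun c hc k => (hθ c k).1 hc, fun c k => (hθ c k).2⟩

/-- At the old angle `A = c B`, so `A - d B = -(d - c) B` there has the sign opposite to that at the
left node. This forces a zero for `d` strictly to the left. -/
theorem angle_lt (h : Interlacing A B n t) {θ : ℝ → Fin n → ℝ}
    (hθ : ∀ c ∈ Set.Ioo (A.eval (-1) / B.eval (-1)) (A.eval 1 / B.eval 1), ∀ k : Fin n,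
      θ c k ∈ Set.Ioo (t k) (t (k + 1)) ∧ (A - C c * B).eval (Real.cos (θ c k)) = 0)
    {c d : ℝ} (hc : c ∈ Set.Ioo (A.eval (-1) / B.eval (-1)) (A.eval 1 / B.eval 1))
    (hd : d ∈ Set.Ioo (A.eval (-1) / B.eval (-1)) (A.eval 1 / B.eval 1)) (hcd : c < d)
    (k : Fin n) : θ d k < θ c k := by
  obtain ⟨hmem, h0⟩ := hθ c hc k
  have hB := h.sign_right k k.2 _ hmem.1 hmem.2
  have hneg : (-1) ^ (k : ℕ) * (A - C d * B).eval (Real.cos (θ c k)) < 0 := by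
    simp only [eval_sub, eval_mul, eval_C] at h0 ⊢
    have : (-1) ^ (k : ℕ) * (A.eval (Real.cos (θ c k)) - d * B.eval (Real.cos (θ c k))) =
        -((d - c) * ((-1) ^ (k : ℕ) * B.eval (Real.cos (θ c k)))) := by
      linear_combination (-1) ^ (k : ℕ) * h0
    rw [this]
    exact neg_neg_of_pos (mul_pos (sub_pos.2 hcd) hB)
  obtain ⟨φ, hφ, hφ0⟩ := exists_root_of_sign hmem.1.le
    (h.sign_sub (c := d) k.2.le (fun _ => hd.2) (fun _ => hd.1)) hneg
  have hφmem : φ ∈ Set.Ioo (t k) (t (k + 1)) := ⟨hφ.1, hφ.2.trans hmem.2⟩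
  have hinj : Function.Injective fun j => Real.cos (θ d j) := fun i j hij =>
    Fin.ext (h.cos_injective i.2 j.2 (hθ d hd i).1 (hθ d hd j).1 hij)
  -- The zeros already chosen for `d`, one per interval, are all of them, so the zero `φ` just found
  -- must be the chosen one of interval `k`.
  have hprod := eq_C_mul_prod (h.natDegree_sub_le d) hinj (fun j => (hθ d hd j).2)
  rw [hprod, eval_mul, eval_C, eval_prod, mul_eq_zero, Finset.prod_eq_zero_iff] at hφ0
  obtain ⟨j, -, hj⟩ := hφ0.resolve_left (h.coeff_sub_pos d).ne'
  have hcos : Real.cos φ = Real.cos (θ d j) := by simpa [sub_eq_zero] using hj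
  have hjk : (k : ℕ) = j := h.cos_injective k.2 j.2 hφmem (hθ d hd j).1 hcos
  obtain rfl := Fin.ext hjk
  have h1 := h.mem_Ioo_pi k.2 hφmem
  have h2 := h.mem_Ioo_pi k.2 (hθ d hd k).1
  rw [← Real.injOn_cos ⟨h1.1.le, h1.2.le⟩ ⟨h2.1.le, h2.2.le⟩ hcos]
  exact hφ.2

end Interlacing

/-! ### Phases of the Chebyshev polynomials and their interlacing -/

namespace ChebKind

/-- The phase of `Q_n (cos θ)` is `(slope + 1) * θ + shift * π`. -/
noncomputable def shift : ChebKind → ℝ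
  | .T => 1 / 2
  | .U => 0
  | .V => 1 / 2
  | .W => 0

/-- The phase of `Q_{n-1} (cos θ)` is `slope * θ + shift * π`. -/
noncomputable def slope (n : ℕ) : ChebKind → ℝ
  | .T => n - 1
  | .U => n
  | .V => n - 1 / 2
  | .W => n - 1 / 2

/-- The angles `0`, `arccos` of the zeros of `Q_{n-1}`, and `π`. -/
noncomputable def node (α : ChebKind) (n k : ℕ) : ℝ :=
  if k = 0 then 0 else if n ≤ k then Real.pi else (k - α.shift) * Real.pi / α.slope n

/-- The weight is the denominator in the trigonometric definition, or `1` for the first kind. It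
does not depend on the degree and is positive on `(0, π)`, so signs of polynomials become signs of
sines. -/
theorem exists_weight (α : ChebKind) {n : ℕ} (hn : 1 ≤ n) {θ : ℝ} (h0 : 0 < θ)
    (h1 : θ < Real.pi) : ∃ w, 0 < w ∧
      (α.poly n).eval (Real.cos θ) * w = Real.sin ((α.slope n + 1) * θ + α.shift * Real.pi) ∧
      (α.poly (n - 1)).eval (Real.cos θ) * w =
        Real.sin (α.slope n * θ + α.shift * Real.pi) := by
  have hs : 0 < Real.sin θ := Real.sin_pos_of_pos_of_lt_pi h0 h1
  have hcast : ((n - 1 : ℕ) : ℝ) = n - 1 := by push_cast [hn]; ring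
  have hhalf : (1 / 2 : ℝ) * Real.pi = Real.pi / 2 := by ring
  cases α
  · refine ⟨1, one_pos, ?_, ?_⟩
    · rw [mul_one, eval_T_cos, shift, slope, hhalf, Real.sin_add_pi_div_two]
      congr 1; ring
    · rw [mul_one, eval_T_cos, shift, slope, hhalf, Real.sin_add_pi_div_two, hcast]
  · refine ⟨Real.sin θ, hs, ?_, ?_⟩
    · rw [eval_U_cos, shift, slope]
      congr 1; ring
    · rw [eval_U_cos, shift, slope, hcast]
      congr 1; ring
  · refine ⟨Real.cos (θ / 2), Real.cos_pos_of_mem_Ioo ⟨by linarith, by linarith⟩, ?_, ?_⟩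
    · rw [eval_V_cos n θ hs.ne', shift, slope, hhalf, Real.sin_add_pi_div_two]
      congr 1; ring
    · rw [eval_V_cos _ θ hs.ne', shift, slope, hhalf, Real.sin_add_pi_div_two, hcast]
      congr 1; ring
  · refine ⟨Real.sin (θ / 2), Real.sin_pos_of_pos_of_lt_pi (by linarith) (by linarith), ?_, ?_⟩
    · rw [eval_W_cos n θ hs.ne', shift, slope]
      congr 1; ring
    · rw [eval_W_cos _ θ hs.ne', shift, slope, hcast]
      congr 1; ring

theorem shift_lt_one (α : ChebKind) : α.shift < 1 := by cases α <;> norm_num [shift]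

/-- For the first kind the slope is `0` at `n = 1`; interior nodes, where one divides by it, exist
only for `n ≥ 2`. -/
theorem slope_pos (α : ChebKind) {n : ℕ} (hn : 2 ≤ n) : 0 < α.slope n := by
  have : (2 : ℝ) ≤ n := by exact_mod_cast hn
  cases α <;> simp only [slope] <;> linarith

/-- The right side is the phase of `B` at `θ = π` in units of `π`, so the phase `(n - 1)π` is
reached before `π`. -/
theorem lt_slope_add_shift (α : ChebKind) (n : ℕ) : (n : ℝ) - 1 < α.slope n + α.shift := by
  cases α <;> simp only [slope, shift] <;> linarith

theorem phase_pos (α : ChebKind) {n : ℕ} (hn : 1 ≤ n) {θ : ℝ} (h0 : 0 < θ) :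
    0 < α.slope n * θ + α.shift * Real.pi := by
  have : (1 : ℝ) ≤ n := by exact_mod_cast hn
  have hpi := Real.pi_pos
  cases α <;> simp only [slope, shift]
  · nlinarith [mul_nonneg (sub_nonneg.2 this) h0.le]
  · nlinarith
  · nlinarith
  · nlinarith

theorem phase_lt (α : ChebKind) {n : ℕ} (hn : 1 ≤ n) {θ : ℝ} (h1 : θ < Real.pi) :
    α.slope n * θ + α.shift * Real.pi < n * Real.pi := by
  have : (1 : ℝ) ≤ n := by exact_mod_cast hn
  have hpi := Real.pi_pos
  cases α <;> simp only [slope, shift]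
  · nlinarith [mul_nonneg (sub_nonneg.2 this) (sub_pos.2 h1).le]
  · nlinarith
  · nlinarith
  · nlinarith

theorem node_zero (α : ChebKind) (n : ℕ) : α.node n 0 = 0 := by simp [node]

theorem node_last (α : ChebKind) {n : ℕ} (hn : 1 ≤ n) : α.node n n = Real.pi := by
  simp [node, Nat.one_le_iff_ne_zero.1 hn]

theorem slope_mul_node (α : ChebKind) {n k : ℕ} (hk0 : 0 < k) (hkn : k < n) :
    α.slope n * α.node n k = (k - α.shift) * Real.pi := by
  rw [node, if_neg hk0.ne', if_neg hkn.not_ge, mul_div_cancel₀ _ (α.slope_pos (by omega)).ne']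

theorem node_pos (α : ChebKind) {n k : ℕ} (hk0 : 0 < k) (hkn : k < n) : 0 < α.node n k := by
  have h := α.slope_mul_node hk0 hkn
  have hk : (1 : ℝ) ≤ k := by exact_mod_cast hk0
  refine pos_of_mul_pos_right (a := α.slope n) ?_ (α.slope_pos (by omega)).le
  rw [h]
  exact mul_pos (by linarith [α.shift_lt_one]) Real.pi_pos

theorem node_lt_pi (α : ChebKind) {n k : ℕ} (hk0 : 0 < k) (hkn : k < n) :
    α.node n k < Real.pi := by
  have h := α.slope_mul_node hk0 hkn
  have hk : (k : ℝ) ≤ n - 1 := by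
    have : (k : ℝ) + 1 ≤ n := by exact_mod_cast hkn
    linarith
  refine lt_of_mul_lt_mul_left (a := α.slope n) ?_ (α.slope_pos (by omega)).le
  rw [h]
  exact mul_lt_mul_of_pos_right (by linarith [α.lt_slope_add_shift n]) Real.pi_pos

theorem node_lt_node_succ (α : ChebKind) {n k : ℕ} (hkn : k < n) :
    α.node n k < α.node n (k + 1) := by
  rcases Nat.eq_zero_or_pos k with rfl | hk0
  · rw [node_zero]
    rcases (Nat.succ_le_of_lt hkn).eq_or_lt with h | h
    · rw [← h, node_last _ le_rfl]
      exact Real.pi_pos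
    · exact α.node_pos one_pos h
  rcases (Nat.succ_le_of_lt hkn).eq_or_lt with h | h
  · rw [show k + 1 = n from h, node_last _ (by omega)]
    exact α.node_lt_pi hk0 hkn
  · refine lt_of_mul_lt_mul_left (a := α.slope n) ?_ (α.slope_pos (by omega)).le
    rw [α.slope_mul_node hk0 hkn, α.slope_mul_node (Nat.succ_pos k) h]
    push_cast
    nlinarith [Real.pi_pos]

theorem lt_phase (α : ChebKind) {n k : ℕ} (hkn : k < n) {θ : ℝ} (hθ : α.node n k < θ) :
    k * Real.pi < α.slope n * θ + α.shift * Real.pi := by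
  rcases Nat.eq_zero_or_pos k with rfl | hk0
  · rw [node_zero] at hθ
    simpa using α.phase_pos (by omega) hθ
  · have := mul_lt_mul_of_pos_left hθ (α.slope_pos (n := n) (by omega))
    rw [α.slope_mul_node hk0 hkn] at this
    linarith

theorem phase_lt_succ (α : ChebKind) {n k : ℕ} (hkn : k < n) {θ : ℝ}
    (hθ : θ < α.node n (k + 1)) :
    α.slope n * θ + α.shift * Real.pi < (k + 1 : ℕ) * Real.pi := by
  rcases (Nat.succ_le_of_lt hkn).eq_or_lt with h | h
  · rw [show k + 1 = n from h] at hθ ⊢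
    rw [node_last _ (by omega)] at hθ
    exact α.phase_lt (by omega) hθ
  · have := mul_lt_mul_of_pos_left hθ (α.slope_pos (n := n) (by omega))
    rw [α.slope_mul_node (Nat.succ_pos k) h] at this
    linarith

theorem eval_one_pos (α : ChebKind) (n : ℕ) : 0 < (α.poly n).eval 1 := by
  have : (0 : ℝ) ≤ n := n.cast_nonneg
  cases α <;>
    simp only [poly, eval_sub, eval_add, Chebyshev.T_eval_one, Chebyshev.U_eval_one] <;>
    push_cast <;> linarith

theorem eval_neg_one_pos (α : ChebKind) (n : ℕ) : 0 < (-1) ^ n * (α.poly n).eval (-1) := by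
  have h0 : (0 : ℝ) ≤ n := n.cast_nonneg
  have h1 : (((n : ℤ).negOnePow : ℤ) : ℝ) = (-1) ^ n := by
    rw [Int.negOnePow_def]; simp
  have h2 : ((((n : ℤ) - 1).negOnePow : ℤ) : ℝ) = -(-1) ^ n := by
    rw [Int.negOnePow_sub, Int.negOnePow_one]; push_cast; rw [h1]; ring
  have h3 : (-1 : ℝ) ^ n * (-1) ^ n = 1 := by rw [← mul_pow]; simp
  cases α <;>
    simp only [poly, eval_sub, eval_add, Chebyshev.T_eval_neg_one, Chebyshev.U_eval_neg_one,
      h1, h2] <;>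
    push_cast <;> nlinarith

theorem natDegree_U_sub_one_le {n : ℕ} :
    (Chebyshev.U ℝ ((n : ℤ) - 1)).natDegree ≤ n := by
  rw [Chebyshev.natDegree_U]
  omega

theorem natDegree_poly_le (α : ChebKind) (n : ℕ) : (α.poly n).natDegree ≤ n := by
  cases α
  · simp [poly, Chebyshev.natDegree_T]
  · simp [poly, Chebyshev.natDegree_U_natCast]
  · exact (natDegree_sub_le _ _).trans
      (max_le (Chebyshev.natDegree_U_natCast ℝ n).le natDegree_U_sub_one_le)
  · exact (natDegree_add_le _ _).trans
      (max_le (Chebyshev.natDegree_U_natCast ℝ n).le natDegree_U_sub_one_le)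

theorem coeff_poly_pos (α : ChebKind) {n : ℕ} (hn : 1 ≤ n) : 0 < (α.poly n).coeff n := by
  have hT : 0 < (Chebyshev.T ℝ n).coeff n := by
    have h := Chebyshev.leadingCoeff_T ℝ n
    rw [leadingCoeff, Chebyshev.natDegree_T, Int.natAbs_natCast] at h
    rw [h]
    positivity
  have hU : 0 < (Chebyshev.U ℝ n).coeff n := by
    have h := Chebyshev.leadingCoeff_U_natCast ℝ n
    rw [leadingCoeff, Chebyshev.natDegree_U_natCast] at h
    rw [h]
    positivity
  have hU' : (Chebyshev.U ℝ ((n : ℤ) - 1)).coeff n = 0 := by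
    refine coeff_eq_zero_of_natDegree_lt ?_
    obtain ⟨m, rfl⟩ : ∃ m, n = m + 1 := ⟨n - 1, by omega⟩
    rw [Nat.cast_succ, add_sub_cancel_right, Chebyshev.natDegree_U_natCast]
    exact Nat.lt_succ_self m
  cases α <;> simpa [poly, hU'] using by assumption

theorem interlacing (α : ChebKind) {n : ℕ} (hn : 1 ≤ n) :
    Interlacing (α.poly n) (α.poly (n - 1)) n (α.node n) where
  pos := hn
  natDegree_le := α.natDegree_poly_le n
  coeff_pos := α.coeff_poly_pos hn
  natDegree_lt := (α.natDegree_poly_le (n - 1)).trans_lt (by omega)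
  t_zero := α.node_zero n
  t_last := α.node_last hn
  t_lt _ hk := α.node_lt_node_succ hk
  sign_left k hk := by
    rcases Nat.eq_zero_or_pos k with rfl | hk0
    · simpa [node_zero] using α.eval_one_pos n
    rcases hk.eq_or_lt with rfl | hkn
    · simpa [node_last _ hn] using α.eval_neg_one_pos k
    have h0 := α.node_pos hk0 hkn
    have h1 := α.node_lt_pi hk0 hkn
    obtain ⟨w, hw, hA, -⟩ := α.exists_weight hn h0 h1
    -- At a zero of `B` the phase of `B` is `kπ`; that of `A` exceeds it by the angle itself, so `A`
    -- carries the sign of `(-1)^k sin θ`.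
    have hphase : (α.slope n + 1) * α.node n k + α.shift * Real.pi =
        α.node n k + k * Real.pi := by
      linear_combination α.slope_mul_node hk0 hkn
    rw [hphase, Real.sin_add_nat_mul_pi] at hA
    refine pos_of_mul_pos_left (b := w) ?_ hw.le
    rw [mul_assoc, hA, ← mul_assoc, ← mul_pow, neg_one_mul, neg_neg, one_pow, one_mul]
    exact Real.sin_pos_of_pos_of_lt_pi h0 h1
  root_right k hk0 hkn := by
    obtain ⟨w, hw, -, hB⟩ := α.exists_weight hn (α.node_pos hk0 hkn) (α.node_lt_pi hk0 hkn)
    have hphase : α.slope n * α.node n k + α.shift * Real.pi = k * Real.pi := by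
      linear_combination α.slope_mul_node hk0 hkn
    rw [hphase, Real.sin_nat_mul_pi] at hB
    exact (mul_eq_zero.1 hB).resolve_right hw.ne'
  right_one := α.eval_one_pos (n - 1)
  right_neg_one := α.eval_neg_one_pos (n - 1)
  sign_right k hk θ hθ0 hθ1 := by
    have h0 : 0 < θ := by
      refine lt_of_le_of_lt ?_ hθ0
      rcases Nat.eq_zero_or_pos k with rfl | hk0
      · rw [node_zero]
      · exact (α.node_pos hk0 hk).le
    have h1 : θ < Real.pi := by
      refine hθ1.trans_le ?_
      rcases (Nat.succ_le_of_lt hk).eq_or_lt with h | h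
      · rw [show k + 1 = n from h, node_last _ hn]
      · exact (α.node_lt_pi (Nat.succ_pos k) h).le
    obtain ⟨w, hw, -, hB⟩ := α.exists_weight hn h0 h1
    refine pos_of_mul_pos_left (b := w) ?_ hw.le
    -- Between consecutive nodes the phase of `B` stays in `(kπ, (k + 1)π)`.
    rw [mul_assoc, hB, ← Real.sin_sub_nat_mul_pi]
    have h2 := α.lt_phase hk hθ0
    have h3 := α.phase_lt_succ hk hθ1
    push_cast at h3
    exact Real.sin_pos_of_pos_of_lt_pi (by linarith) (by linarith)

end ChebKind

/-! ### The substitution `w = (z + 1/z)/2` and the factorization of `P` -/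

namespace ChebKind

/-- This is `T_n((z + 1/z)/2) = (z^n + z^{-n})/2` with denominators cleared, proved by the
three-term recurrence. -/
theorem two_mul_pow_mul_eval_T {z w : ℝ} (h : 2 * w * z = z ^ 2 + 1) (n : ℕ) :
    2 * z ^ n * (Chebyshev.T ℝ n).eval w = z ^ (2 * n) + 1 := by
  induction n using Nat.twoStepInduction with
  | zero => norm_num
  | one => simp; linear_combination h
  | more n ih1 ih2 =>
    push_cast at ih2 ⊢
    rw [Chebyshev.T_add_two]
    simp only [eval_sub, eval_mul, eval_X, eval_ofNat]
    linear_combination 2 * w * z * ih2 - z ^ 2 * ih1 + (z ^ (2 * n + 2) + 1) * h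

theorem pow_mul_eval_U {z w : ℝ} (h : 2 * w * z = z ^ 2 + 1) (n : ℕ) :
    (z ^ 2 - 1) * (z ^ n * (Chebyshev.U ℝ n).eval w) = z ^ (2 * n + 2) - 1 := by
  induction n using Nat.twoStepInduction with
  | zero => simp
  | one => simp; linear_combination (z ^ 2 - 1) * h
  | more n ih1 ih2 =>
    push_cast at ih2 ⊢
    rw [Chebyshev.U_add_two]
    simp only [eval_sub, eval_mul, eval_X, eval_ofNat]
    linear_combination 2 * w * z * ih2 - z ^ 2 * ih1 + (z ^ (2 * n + 4) - 1) * h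

theorem pow_mul_eval_U_sub_one {z w : ℝ} (h : 2 * w * z = z ^ 2 + 1) (n : ℕ) :
    (z ^ 2 - 1) * (z ^ n * (Chebyshev.U ℝ ((n : ℤ) - 1)).eval w) = z * (z ^ (2 * n) - 1) := by
  cases n with
  | zero => simp
  | succ m =>
    rw [Nat.cast_succ, add_sub_cancel_right]
    linear_combination z * pow_mul_eval_U h m

/-- The difference of the two second-kind identities carries a factor `z - 1`, cancelled because `z
> 1`. The restriction is harmless: infinitely many `z` determine a polynomial. -/
theorem pow_mul_eval_V {z w : ℝ} (hz : 1 < z) (h : 2 * w * z = z ^ 2 + 1) (n : ℕ) :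
    (z + 1) * (z ^ n * (V.poly n).eval w) = z ^ (2 * n + 1) + 1 := by
  have h1 := pow_mul_eval_U h n
  have h2 := pow_mul_eval_U_sub_one h n
  refine mul_left_cancel₀ (sub_ne_zero.2 hz.ne') ?_
  simp only [poly, eval_sub]
  linear_combination h1 - h2

theorem pow_mul_eval_W {z w : ℝ} (hz : 1 < z) (h : 2 * w * z = z ^ 2 + 1) (n : ℕ) :
    (z - 1) * (z ^ n * (W.poly n).eval w) = z ^ (2 * n + 1) - 1 := by
  have h1 := pow_mul_eval_U h n
  have h2 := pow_mul_eval_U_sub_one h n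
  refine mul_left_cancel₀ (by linarith : z + 1 ≠ 0) ?_
  simp only [poly, eval_add]
  linear_combination h1 + h2

theorem IsP.coeff_symm {α : ChebKind} {n : ℕ} {P : ℝ[X]} (h : α.IsP n P) {j : ℕ}
    (hj : j ≤ 2 * n) : P.coeff j = P.coeff (2 * n - j) := by
  conv_lhs => rw [← h.selfReciprocal, coeff_reverse, h.natDegree_eq, revAt_le hj]

/-- The classes prescribe only the upper half of the coefficients; a symmetric formula `f` extends
to the lower half by self-reciprocity, leaving sums in closed form. -/
theorem IsP.eq_sum {α : ChebKind} {n : ℕ} {P : ℝ[X]} (h : α.IsP n P) {f : ℕ → ℝ}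
    (hsymm : ∀ j ≤ 2 * n, f (2 * n - j) = f j)
    (hf : ∀ j, n ≤ j → j ≤ 2 * n → P.coeff j = f j) (z : ℝ) :
    P.eval z = ∑ j ∈ Finset.range (2 * n + 1), f j * z ^ j := by
  rw [eval_eq_sum_range, h.natDegree_eq]
  refine Finset.sum_congr rfl fun j hj => ?_
  have hj' : j ≤ 2 * n := by simpa [Nat.lt_succ_iff] using hj
  congr 1
  rcases le_total n j with hnj | hnj
  · exact hf j hnj hj'
  · rw [h.coeff_symm hj', hf _ (by omega) (by omega), hsymm j hj']

theorem sum_range_pair {N a b : ℕ} (ha : a < N) (hb : b < N) (hab : a ≠ b) (z : ℝ) :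
    ∑ j ∈ Finset.range N, (if j = a ∨ j = b then (1 : ℝ) else 0) * z ^ j = z ^ a + z ^ b := by
  have : ∀ j : ℕ, (if j = a ∨ j = b then (1 : ℝ) else 0) * z ^ j =
      (if j = a then z ^ a else 0) + (if j = b then z ^ b else 0) := by
    intro j
    by_cases h0 : j = a
    · subst h0
      simp [hab]
    · by_cases h1 : j = b <;> simp [h0, h1]
      exact fun h => absurd h.symm hab
  simp only [this, Finset.sum_add_distrib, Finset.sum_ite_eq', Finset.mem_range, ha, hb, if_true]

theorem sum_range_neg_one_pow (n : ℕ) (z : ℝ) :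
    (z + 1) * ∑ j ∈ Finset.range (2 * n + 1), (-1) ^ j * z ^ j = z ^ (2 * n + 1) + 1 := by
  have h := mul_geom_sum (-z) (2 * n + 1)
  rw [Odd.neg_pow ⟨n, rfl⟩] at h
  simp only [← mul_pow, neg_one_mul]
  linear_combination -h

theorem sum_range_pow (n : ℕ) (z : ℝ) :
    (z - 1) * ∑ j ∈ Finset.range (2 * n + 1), z ^ j = z ^ (2 * n + 1) - 1 :=
  mul_geom_sum z (2 * n + 1)

theorem neg_one_pow_two_mul_sub {n j : ℕ} (hj : j ≤ 2 * n) :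
    (-1 : ℝ) ^ (2 * n - j) = (-1) ^ j := by
  have h : (-1 : ℝ) ^ (2 * n - j) * (-1) ^ j = 1 := by
    rw [← pow_add, Nat.sub_add_cancel hj]
    simp
  rcases neg_one_pow_eq_or ℝ j with h' | h' <;> rw [h'] at h ⊢ <;> linarith

theorem IsP.eval_eq_T {n : ℕ} {P : ℝ[X]} (h : T.IsP n P) {z w : ℝ}
    (hw : 2 * w * z = z ^ 2 + 1) : P.eval z = 2 * z ^ n * (T.quasi n P).eval w := by
  obtain ⟨hn, h0, -⟩ := h.coeffCond
  -- Only the two outer pairs of coefficients survive; `n ≥ 2` keeps the indices `1` and `2n - 1`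
  -- distinct.
  have hP := h.eq_sum (f := fun j => P.coeff (2 * n) * (if j = 0 ∨ j = 2 * n then 1 else 0) +
    P.coeff (2 * n - 1) * (if j = 1 ∨ j = 2 * n - 1 then 1 else 0)) (fun j hj => by grind)
    (fun j hj hj' => by
      by_cases h1 : j = 2 * n
      · simp [h1, show 2 * n ≠ 1 by omega, show 2 * n ≠ 2 * n - 1 by omega]
      · by_cases h2 : j = 2 * n - 1
        · simp [h2, show 2 * n - 1 ≠ 0 by omega, show 2 * n - 1 ≠ 2 * n by omega]
        · simp [h1, h2, show j ≠ 0 by omega, show j ≠ 1 by omega, h0 j hj (by omega)]) z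
  simp only [add_mul, mul_assoc, Finset.sum_add_distrib, ← Finset.mul_sum] at hP
  rw [sum_range_pair (by omega) (by omega) (by omega),
    sum_range_pair (by omega) (by omega) (by omega)] at hP
  obtain ⟨m, rfl⟩ : ∃ m, n = m + 1 := ⟨n - 1, by omega⟩
  have h1 := two_mul_pow_mul_eval_T hw (m + 1)
  have h2 := two_mul_pow_mul_eval_T hw m
  simp only [quasi, eval_add, eval_mul, eval_C, poly, Nat.add_sub_cancel,
    show 2 * (m + 1) - 1 = 2 * m + 1 by omega] at hP ⊢
  rw [hP]
  linear_combination -P.coeff (2 * (m + 1)) * h1 - P.coeff (2 * m + 1) * z * h2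

theorem IsP.eval_eq_U {n : ℕ} (hn : 1 ≤ n) {P : ℝ[X]} (h : U.IsP n P) {z w : ℝ} (hz : 1 < z)
    (hw : 2 * w * z = z ^ 2 + 1) : P.eval z = 2 * z ^ n * (U.quasi n P).eval w := by
  obtain ⟨heven, hodd, -⟩ := h.coeffCond
  -- Coefficients alternating by parity are a constant plus a multiple of `(-1)^j`, hence two
  -- geometric sums.
  have hP := h.eq_sum (f := fun j => (P.coeff (2 * n) + P.coeff (2 * n - 1)) / 2 * 1 +
    (P.coeff (2 * n) - P.coeff (2 * n - 1)) / 2 * (-1) ^ j)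
    (fun j hj => by simp only [neg_one_pow_two_mul_sub hj])
    (fun j hj hj' => by
      rcases Nat.even_or_odd j with hpar | hpar
      · rw [heven j hj hj' hpar, hpar.neg_one_pow]; ring
      · rw [hodd j hj hj' hpar, hpar.neg_one_pow]; ring) z
  simp only [add_mul, mul_assoc, Finset.sum_add_distrib, ← Finset.mul_sum, one_mul] at hP
  obtain ⟨m, rfl⟩ : ∃ m, n = m + 1 := ⟨n - 1, by omega⟩
  have h1 := pow_mul_eval_U hw (m + 1)
  have h2 := pow_mul_eval_U hw m
  have h3 := sum_range_pow (m + 1) z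
  have h4 := sum_range_neg_one_pow (m + 1) z
  have hne : z ^ 2 - 1 ≠ 0 := by nlinarith
  refine mul_left_cancel₀ hne ?_
  simp only [quasi, eval_add, eval_mul, eval_C, poly, Nat.add_sub_cancel] at hP ⊢
  rw [hP]
  linear_combination -P.coeff (2 * (m + 1)) * h1 - P.coeff (2 * (m + 1) - 1) * z * h2 +
    (P.coeff (2 * (m + 1)) + P.coeff (2 * (m + 1) - 1)) / 2 * (z + 1) * h3 +
    (P.coeff (2 * (m + 1)) - P.coeff (2 * (m + 1) - 1)) / 2 * (z - 1) * h4

theorem IsP.eval_eq_V {n : ℕ} (hn : 1 ≤ n) {P : ℝ[X]} (h : V.IsP n P) {z w : ℝ} (hz : 1 < z)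
    (hw : 2 * w * z = z ^ 2 + 1) : P.eval z = 2 * z ^ n * (V.quasi n P).eval w := by
  obtain ⟨hcoeff, -⟩ := h.coeffCond
  -- An alternating sequence over the full range, corrected at the two extreme indices.
  have hP := h.eq_sum (f := fun j => -P.coeff (2 * n - 1) * (-1) ^ j +
    (P.coeff (2 * n) + P.coeff (2 * n - 1)) * (if j = 0 ∨ j = 2 * n then 1 else 0))
    (fun j hj => by
      simp only [neg_one_pow_two_mul_sub hj]
      congr 2
      grind)
    (fun j hj hj' => by
      by_cases h1 : j = 2 * n
      · simp [h1]
      · rw [hcoeff j hj (by omega)]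
        simp [h1, show j ≠ 0 by omega]
        ring) z
  simp only [add_mul, mul_assoc, Finset.sum_add_distrib, ← Finset.mul_sum] at hP
  simp only [← add_mul] at hP
  rw [sum_range_pair (by omega) (by omega) (by omega)] at hP
  obtain ⟨m, rfl⟩ : ∃ m, n = m + 1 := ⟨n - 1, by omega⟩
  have h1 := pow_mul_eval_V hz hw (m + 1)
  have h2 := pow_mul_eval_V hz hw m
  have h4 := sum_range_neg_one_pow (m + 1) z
  refine mul_left_cancel₀ (by linarith : z + 1 ≠ 0) ?_
  simp only [quasi, eval_add, eval_mul, eval_C, Nat.add_sub_cancel] at hP ⊢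
  rw [hP]
  linear_combination -P.coeff (2 * (m + 1)) * h1 -
    (P.coeff (2 * (m + 1)) + P.coeff (2 * (m + 1) - 1)) * z * h2 -
    P.coeff (2 * (m + 1) - 1) * h4

theorem IsP.eval_eq_W {n : ℕ} (hn : 1 ≤ n) {P : ℝ[X]} (h : W.IsP n P) {z w : ℝ} (hz : 1 < z)
    (hw : 2 * w * z = z ^ 2 + 1) : P.eval z = 2 * z ^ n * (W.quasi n P).eval w := by
  obtain ⟨hcoeff, -⟩ := h.coeffCond
  have hP := h.eq_sum (f := fun j => P.coeff (2 * n - 1) * 1 +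
    (P.coeff (2 * n) - P.coeff (2 * n - 1)) * (if j = 0 ∨ j = 2 * n then 1 else 0))
    (fun j hj => by grind)
    (fun j hj hj' => by
      by_cases h1 : j = 2 * n
      · simp [h1]
      · rw [hcoeff j hj (by omega)]
        simp [h1, show j ≠ 0 by omega]) z
  simp only [add_mul, mul_assoc, Finset.sum_add_distrib, ← Finset.mul_sum, one_mul] at hP
  rw [sum_range_pair (by omega) (by omega) (by omega)] at hP
  obtain ⟨m, rfl⟩ : ∃ m, n = m + 1 := ⟨n - 1, by omega⟩
  have h1 := pow_mul_eval_W hz hw (m + 1)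
  have h2 := pow_mul_eval_W hz hw m
  have h4 := sum_range_pow (m + 1) z
  refine mul_left_cancel₀ (sub_ne_zero.2 hz.ne') ?_
  simp only [quasi, eval_add, eval_mul, eval_C, Nat.add_sub_cancel] at hP ⊢
  rw [hP]
  linear_combination -P.coeff (2 * (m + 1)) * h1 -
    (P.coeff (2 * (m + 1) - 1) - P.coeff (2 * (m + 1))) * z * h2 +
    P.coeff (2 * (m + 1) - 1) * h4

/-- `P(z) = 2 z ^ n R((z + 1 / z) / 2)`. -/
theorem IsP.eval_eq {α : ChebKind} {n : ℕ} (hn : 1 ≤ n) {P : ℝ[X]} (h : α.IsP n P) {z w : ℝ}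
    (hz : 1 < z) (hw : 2 * w * z = z ^ 2 + 1) :
    P.eval z = 2 * z ^ n * (α.quasi n P).eval w := by
  cases α
  · exact h.eval_eq_T hw
  · exact h.eval_eq_U hn hz hw
  · exact h.eval_eq_V hn hz hw
  · exact h.eval_eq_W hn hz hw

theorem IsP.ne_zero {α : ChebKind} {n : ℕ} (hn : 1 ≤ n) {P : ℝ[X]} (h : α.IsP n P) : P ≠ 0 := by
  rintro rfl
  have := h.natDegree_eq
  rw [natDegree_zero] at this
  omega

/-- The parameter is minus the quotient of the two coefficients of `R`, in each of the four classes.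
-/
theorem IsP.quasi_eq {α : ChebKind} {n : ℕ} (hn : 1 ≤ n) {P : ℝ[X]} (h : α.IsP n P) :
    ∃ a ≠ 0, α.quasi n P = C a * (α.poly n - C (α.param n P) * α.poly (n - 1)) := by
  have h0 : P.coeff (2 * n) ≠ 0 := by
    rw [← h.natDegree_eq]
    exact leadingCoeff_ne_zero.2 (h.ne_zero hn)
  have hcomb : ∀ a b c : ℝ, -(a * c) = b → ∀ A B : ℝ[X],
      C a * A + C b * B = C a * (A - C c * B) := by
    rintro a _ c rfl A B
    simp only [C_neg, C_mul]
    ring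
  cases α
  · refine ⟨_, h0, hcomb _ _ _ ?_ _ _⟩
    simp only [param]
    field_simp
  all_goals
    refine ⟨_, div_ne_zero h0 two_ne_zero, hcomb _ _ _ ?_ _ _⟩
    simp only [param]
    field_simp
    try ring

/-- The factorization of `P` over the zeros of `R`. -/
theorem IsP.eq_prod {α : ChebKind} {n : ℕ} (hn : 1 ≤ n) {P : ℝ[X]} (h : α.IsP n P)
    {x : Fin n → ℝ} (hx : Function.Injective x)
    (h0 : ∀ k, (α.poly n - C (α.param n P) * α.poly (n - 1)).eval (x k) = 0) :
    (∃ a ≠ 0, α.quasi n P = C a * ∏ k, (X - C (x k))) ∧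
      ∃ b ≠ 0, P = C b * ∏ k, (X ^ 2 - C (2 * x k) * X + 1) := by
  have hI := α.interlacing hn
  obtain ⟨a, ha, hR⟩ := h.quasi_eq hn
  rw [Interlacing.eq_C_mul_prod (hI.natDegree_sub_le _) hx h0, ← mul_assoc, ← C_mul] at hR
  refine ⟨⟨_, mul_ne_zero ha (hI.coeff_sub_pos _).ne', hR⟩, ?_⟩
  set d := a * (α.poly n - C (α.param n P) * α.poly (n - 1)).coeff n with hd
  have hd0 : d ≠ 0 := mul_ne_zero ha (hI.coeff_sub_pos _).ne'
  -- Each quadratic equals `2z (w - x_k)`, so their product has a factor `(2z)^n`, to be matched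
  -- with `2 z^n d`.
  refine ⟨2 * d / 2 ^ n, by positivity, ?_⟩
  refine eq_of_infinite_eval_eq _ _ ((Set.Ioi_infinite (1 : ℝ)).mono fun z hz => ?_)
  have hz0 : (z : ℝ) ≠ 0 := (one_pos.trans hz).ne'
  rw [Set.mem_ofPred_eq, h.eval_eq hn hz (w := (z ^ 2 + 1) / (2 * z)) (by field_simp), hR]
  simp only [eval_mul, eval_C, eval_prod, eval_sub, eval_X, eval_add, eval_pow, eval_one]
  have hfac : ∀ k, z ^ 2 - 2 * x k * z + 1 = (2 * z) * ((z ^ 2 + 1) / (2 * z) - x k) := by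
    intro k
    field_simp
    ring
  simp only [hfac, Finset.prod_mul_distrib, Finset.prod_const, Finset.card_univ, Fintype.card_fin]
  field_simp

end ChebKind

/-! ### Complex zeros of `z^2 - 2xz + 1` -/

/-- The self-reciprocal quadratic whose zeros satisfy `(z + 1 / z) / 2 = x`. -/
noncomputable def reciprocalQuadratic (x : ℝ) : ℝ[X] := X ^ 2 - C (2 * x) * X + 1

/-- A complex square root of the quarter discriminant treats `|x| < 1`, `|x| = 1` and `|x| > 1`
together. -/
theorem reciprocalQuadratic_map {x : ℝ} {s : ℂ} (hs : s ^ 2 = x ^ 2 - 1) :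
    (reciprocalQuadratic x).map (algebraMap ℝ ℂ) = (X - C (x + s)) * (X - C (x - s)) := by
  have hC : (C s : ℂ[X]) ^ 2 = C (x : ℂ) ^ 2 - 1 := by
    rw [← C_pow, hs, C_sub, C_pow, C_1]
  simp only [reciprocalQuadratic, Polynomial.map_add, Polynomial.map_sub, Polynomial.map_mul,
    Polynomial.map_pow, map_X, map_C, Polynomial.map_one, C_add, C_sub, map_mul, map_ofNat,
    Polynomial.map_ofNat, Complex.coe_algebraMap]
  linear_combination hC

theorem aroots_reciprocalQuadratic {x : ℝ} {s : ℂ} (hs : s ^ 2 = x ^ 2 - 1) :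
    (reciprocalQuadratic x).aroots ℂ = {(x : ℂ) + s, (x : ℂ) - s} := by
  rw [aroots, reciprocalQuadratic_map hs,
    roots_mul (mul_ne_zero (X_sub_C_ne_zero _) (X_sub_C_ne_zero _)), roots_X_sub_C, roots_X_sub_C]
  rfl

theorem exists_sq_eq_sq_sub_one (x : ℝ) : ∃ s : ℂ, s ^ 2 = (x : ℂ) ^ 2 - 1 :=
  IsAlgClosed.exists_pow_nat_eq _ two_pos

theorem reciprocalQuadratic_ne_zero (x : ℝ) : reciprocalQuadratic x ≠ 0 := by
  intro h
  have : (reciprocalQuadratic x).eval 0 = 0 := by rw [h, eval_zero]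
  simp [reciprocalQuadratic] at this

theorem card_aroots_reciprocalQuadratic (x : ℝ) :
    ((reciprocalQuadratic x).aroots ℂ).card = 2 := by
  obtain ⟨s, hs⟩ := exists_sq_eq_sq_sub_one x
  rw [aroots_reciprocalQuadratic hs]
  rfl

theorem mem_aroots_reciprocalQuadratic {x : ℝ} {z : ℂ} :
    z ∈ (reciprocalQuadratic x).aroots ℂ ↔ z ^ 2 + 1 = 2 * x * z := by
  rw [mem_aroots, and_iff_right (reciprocalQuadratic_ne_zero x)]
  simp only [reciprocalQuadratic, map_add, map_sub, map_mul, map_pow, aeval_X, aeval_C, map_one,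
    Complex.coe_algebraMap, map_ofNat]
  constructor <;> intro h <;> linear_combination h

theorem nodup_aroots_reciprocalQuadratic {x : ℝ} (h1 : x ≠ 1) (h2 : x ≠ -1) :
    ((reciprocalQuadratic x).aroots ℂ).Nodup := by
  obtain ⟨s, hs⟩ := exists_sq_eq_sq_sub_one x
  rw [aroots_reciprocalQuadratic hs]
  refine Multiset.nodup_cons.2 ⟨?_, Multiset.nodup_singleton _⟩
  rw [Multiset.mem_singleton]
  intro h
  have hs0 : s = 0 := by linear_combination h / 2
  rw [hs0] at hs
  have : ((x - 1) * (x + 1) : ℝ) = 0 := by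
    have : (((x - 1) * (x + 1) : ℝ) : ℂ) = 0 := by
      push_cast
      linear_combination -hs
    exact_mod_cast this
  rcases mul_eq_zero.1 this with h | h
  · exact h1 (by linarith)
  · exact h2 (by linarith)

theorem aroots_reciprocalQuadratic_one : (reciprocalQuadratic 1).aroots ℂ = {1, 1} := by
  simpa using aroots_reciprocalQuadratic (x := 1) (s := 0) (by norm_num)

theorem aroots_reciprocalQuadratic_neg_one : (reciprocalQuadratic (-1)).aroots ℂ = {-1, -1} := by
  simpa using aroots_reciprocalQuadratic (x := -1) (s := 0) (by norm_num)

theorem aroots_reciprocalQuadratic_cos (θ : ℝ) :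
    (reciprocalQuadratic (Real.cos θ)).aroots ℂ =
      {Complex.exp (θ * Complex.I), Complex.exp (-(θ * Complex.I))} := by
  have h := Complex.sin_sq_add_cos_sq (θ : ℂ)
  rw [aroots_reciprocalQuadratic (s := Complex.sin θ * Complex.I), Complex.exp_mul_I, ← neg_mul,
    Complex.exp_mul_I, Complex.cos_neg, Complex.sin_neg, Complex.ofReal_cos, neg_mul,
    ← sub_eq_add_neg]
  rw [mul_pow, Complex.I_sq, Complex.ofReal_cos]
  linear_combination -h

theorem norm_eq_one_of_mem_aroots {x : ℝ} (h0 : -1 ≤ x) (h1 : x ≤ 1) {z : ℂ}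
    (hz : z ∈ (reciprocalQuadratic x).aroots ℂ) : ‖z‖ = 1 := by
  rw [← Real.cos_arccos h0 h1, aroots_reciprocalQuadratic_cos] at hz
  simp only [Multiset.insert_eq_cons, Multiset.mem_cons, Multiset.mem_singleton] at hz
  rcases hz with rfl | rfl
  · exact Complex.norm_exp_ofReal_mul_I _
  · rw [← neg_mul, ← Complex.ofReal_neg]
    exact Complex.norm_exp_ofReal_mul_I _

theorem aroots_reciprocalQuadratic_of_add_inv {x r : ℝ} (hr : r ≠ 0) (h : r + 1 / r = 2 * x) :
    (reciprocalQuadratic x).aroots ℂ = {(r : ℂ), ((1 / r : ℝ) : ℂ)} := by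
  have hx : x = (r + 1 / r) / 2 := by linarith
  have hr' : (r : ℂ) ≠ 0 := by exact_mod_cast hr
  rw [aroots_reciprocalQuadratic (s := ((r - 1 / r) / 2 : ℝ))]
  · rw [hx]
    congr 1
    · push_cast; ring
    · congr 1; push_cast; ring
  · rw [hx]
    push_cast
    field_simp
    ring

theorem exists_add_inv_of_one_lt {x : ℝ} (hx : 1 < x) :
    ∃ r : ℝ, 1 < r ∧ r + 1 / r = 2 * x := by
  have h0 : 0 < x ^ 2 - 1 := by nlinarith
  have hs := Real.sq_sqrt h0.le
  have hpos := Real.sqrt_pos.2 h0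
  refine ⟨x + √(x ^ 2 - 1), by linarith, ?_⟩
  have : x + √(x ^ 2 - 1) ≠ 0 := by linarith
  field_simp
  linear_combination hs

theorem exists_add_inv_of_lt_neg_one {x : ℝ} (hx : x < -1) :
    ∃ r : ℝ, r < -1 ∧ r + 1 / r = 2 * x := by
  obtain ⟨r, hr, h⟩ := exists_add_inv_of_one_lt (x := -x) (by linarith)
  refine ⟨-r, by linarith, ?_⟩
  rw [div_neg]
  linarith

/-- A zero `z` is nonzero and recovers `x = (z + 1/z)/2`. Hence multiplicities in a product over
distinct `x_k` come from a single factor. -/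
theorem eq_of_mem_aroots_reciprocalQuadratic {x y : ℝ} {z : ℂ}
    (hx : z ∈ (reciprocalQuadratic x).aroots ℂ) (hy : z ∈ (reciprocalQuadratic y).aroots ℂ) :
    x = y := by
  rw [mem_aroots_reciprocalQuadratic] at hx hy
  have hz : z ≠ 0 := by
    rintro rfl
    simp at hx
  have : (x : ℂ) = y := by
    apply mul_right_cancel₀ (mul_ne_zero two_ne_zero hz)
    linear_combination hy - hx
  exact_mod_cast this

theorem zeroMult_eq_count [DecidableEq ℂ] (P : ℝ[X]) (z : ℂ) :
    zeroMult P z = (P.aroots ℂ).count z := by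
  rw [zeroMult, aroots, count_roots]

theorem offCircleCount_eq_countP (P : ℝ[X]) :
    offCircleCount P = (P.aroots ℂ).countP (fun z => ‖z‖ ≠ 1) := by
  rw [offCircleCount, Multiset.countP_eq_card_filter]

theorem mem_rootSet_iff_mem_aroots {P : ℝ[X]} {z : ℂ} : z ∈ P.rootSet ℂ ↔ z ∈ P.aroots ℂ := by
  rw [rootSet_def, Finset.mem_coe, Multiset.mem_toFinset]

/-! ### Multiplicities and off-circle zeros of a product of quadratics -/

section Product

variable {n : ℕ} {x : Fin n → ℝ} {P : ℝ[X]} {b : ℝ}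

theorem aroots_eq_sum (hb : b ≠ 0) (hP : P = C b * ∏ k, reciprocalQuadratic (x k)) :
    P.aroots ℂ = ∑ k, (reciprocalQuadratic (x k)).aroots ℂ := by
  have h0 : ∏ k, (reciprocalQuadratic (x k)).map (algebraMap ℝ ℂ) ≠ 0 :=
    Finset.prod_ne_zero_iff.2 fun k _ =>
      (Polynomial.map_ne_zero_iff (algebraMap ℝ ℂ).injective).2 (reciprocalQuadratic_ne_zero _)
  rw [hP, aroots_C_mul _ hb, aroots, Polynomial.map_prod, roots_prod _ _ h0]
  rfl

theorem mem_aroots_iff (hb : b ≠ 0) (hP : P = C b * ∏ k, reciprocalQuadratic (x k)) {z : ℂ} :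
    z ∈ P.aroots ℂ ↔ ∃ k, z ∈ (reciprocalQuadratic (x k)).aroots ℂ := by
  rw [aroots_eq_sum hb hP, Multiset.mem_sum]
  simp

theorem zeroMult_eq [DecidableEq ℂ] (hb : b ≠ 0)
    (hP : P = C b * ∏ k, reciprocalQuadratic (x k)) (hx : Function.Injective x) {z : ℂ} {k : Fin n}
    (hz : z ∈ (reciprocalQuadratic (x k)).aroots ℂ) :
    zeroMult P z = ((reciprocalQuadratic (x k)).aroots ℂ).count z := by
  rw [zeroMult_eq_count, aroots_eq_sum hb hP, Multiset.count_sum']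
  refine Finset.sum_eq_single k (fun j _ hj => ?_) (fun h => absurd (Finset.mem_univ k) h)
  exact Multiset.count_eq_zero.2 fun h =>
    hj (hx (eq_of_mem_aroots_reciprocalQuadratic h hz))

/-- A quadratic has a repeated zero only for `x = ±1`, and that zero is `x` itself; the last two
hypotheses exclude exactly this. -/
theorem zeroMult_eq_one (hb : b ≠ 0)
    (hP : P = C b * ∏ k, reciprocalQuadratic (x k)) (hx : Function.Injective x) {z : ℂ}
    (hz : z ∈ P.rootSet ℂ) (h1 : ∀ k, x k = 1 → z ≠ 1) (h2 : ∀ k, x k = -1 → z ≠ -1) :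
    zeroMult P z = 1 := by
  classical
  obtain ⟨k, hk⟩ := (mem_aroots_iff hb hP).1 (mem_rootSet_iff_mem_aroots.1 hz)
  rw [zeroMult_eq hb hP hx hk]
  refine Multiset.count_eq_one_of_mem (nodup_aroots_reciprocalQuadratic ?_ ?_) hk
  · intro h
    rw [h, aroots_reciprocalQuadratic_one] at hk
    exact h1 k h (by simpa using hk)
  · intro h
    rw [h, aroots_reciprocalQuadratic_neg_one] at hk
    exact h2 k h (by simpa using hk)

theorem zeroMult_one_eq_two (hb : b ≠ 0)
    (hP : P = C b * ∏ k, reciprocalQuadratic (x k)) (hx : Function.Injective x) {k : Fin n}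
    (hk : x k = 1) : zeroMult P 1 = 2 := by
  classical
  rw [zeroMult_eq hb hP hx (k := k) (by simp [hk, aroots_reciprocalQuadratic_one]), hk,
    aroots_reciprocalQuadratic_one]
  simp

theorem zeroMult_neg_one_eq_two (hb : b ≠ 0)
    (hP : P = C b * ∏ k, reciprocalQuadratic (x k)) (hx : Function.Injective x) {k : Fin n}
    (hk : x k = -1) : zeroMult P (-1) = 2 := by
  classical
  rw [zeroMult_eq hb hP hx (k := k) (by simp [hk, aroots_reciprocalQuadratic_neg_one]), hk,
    aroots_reciprocalQuadratic_neg_one]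
  simp

theorem zeroMult_neg_one_eq_zero (hb : b ≠ 0)
    (hP : P = C b * ∏ k, reciprocalQuadratic (x k)) (hx : ∀ k, x k ≠ -1) :
    zeroMult P (-1) = 0 := by
  classical
  rw [zeroMult_eq_count, Multiset.count_eq_zero, mem_aroots_iff hb hP]
  rintro ⟨k, hk⟩
  refine hx k (eq_of_mem_aroots_reciprocalQuadratic hk ?_)
  simp [aroots_reciprocalQuadratic_neg_one]

theorem offCircleCount_eq_sum (hb : b ≠ 0) (hP : P = C b * ∏ k, reciprocalQuadratic (x k)) :
    offCircleCount P =
      ∑ k, ((reciprocalQuadratic (x k)).aroots ℂ).countP (fun z => ‖z‖ ≠ 1) := by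
  rw [offCircleCount_eq_countP, aroots_eq_sum hb hP]
  exact map_sum (Multiset.countPAddMonoidHom fun z : ℂ => ‖z‖ ≠ 1) _ _

theorem offCircleCount_le_two (hb : b ≠ 0) (hP : P = C b * ∏ k, reciprocalQuadratic (x k))
    {k₀ : Fin n} (hx : ∀ k, k ≠ k₀ → x k ∈ Set.Ioo (-1 : ℝ) 1) : offCircleCount P ≤ 2 := by
  rw [offCircleCount_eq_sum hb hP, Finset.sum_eq_single k₀ (fun k _ hk => ?_)
    (fun h => absurd (Finset.mem_univ k₀) h), ← card_aroots_reciprocalQuadratic (x k₀)]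
  · exact Multiset.countP_le_card _ _
  · exact Multiset.countP_eq_zero.2 fun z hz hne =>
      hne (norm_eq_one_of_mem_aroots (hx k hk).1.le (hx k hk).2.le hz)

theorem offCircle_eq_pair (hb : b ≠ 0) (hP : P = C b * ∏ k, reciprocalQuadratic (x k))
    {k₀ : Fin n} (hx : ∀ k, k ≠ k₀ → x k ∈ Set.Ioo (-1 : ℝ) 1) {r : ℝ} (hr : 1 < |r|)
    (hrx : r + 1 / r = 2 * x k₀) :
    {z ∈ P.rootSet ℂ | ‖z‖ ≠ 1} = {(r : ℂ), ((1 / r : ℝ) : ℂ)} := by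
  have hr0 : r ≠ 0 := abs_pos.1 (one_pos.trans hr)
  have hroots := aroots_reciprocalQuadratic_of_add_inv hr0 hrx
  ext z
  simp only [mem_rootSet_iff_mem_aroots, mem_aroots_iff hb hP,
    Set.mem_insert_iff, Set.mem_singleton_iff]
  constructor
  · rintro ⟨⟨k, hk⟩, hz⟩
    have hkk : k = k₀ := by
      by_contra hne
      exact hz (norm_eq_one_of_mem_aroots (hx k hne).1.le (hx k hne).2.le hk)
    rw [hkk, hroots] at hk
    simpa using hk
  · intro hz
    refine ⟨⟨k₀, by rw [hroots]; simpa using hz⟩, ?_⟩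
    rcases hz with rfl | rfl
    · rw [Complex.norm_real, Real.norm_eq_abs]
      exact hr.ne'
    · rw [Complex.norm_real, Real.norm_eq_abs, abs_div, abs_one]
      exact ((div_lt_one (one_pos.trans hr)).2 hr).ne

end Product

theorem ncard_rootSet_of_zeroMult_eq_one {P : ℝ[X]} (h : ∀ z ∈ P.rootSet ℂ, zeroMult P z = 1) :
    (P.rootSet ℂ).ncard = P.natDegree := by
  classical
  have hnodup : (P.aroots ℂ).Nodup := Multiset.nodup_iff_count_le_one.2 fun z => by
    rw [← zeroMult_eq_count]
    by_cases hz : z ∈ P.rootSet ℂ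
    · exact (h z hz).le
    · rw [zeroMult_eq_count, Multiset.count_eq_zero.2 (mt mem_rootSet_iff_mem_aroots.2 hz)]
      exact zero_le_one
  rw [rootSet_def, Set.ncard_coe_finset, Multiset.toFinset_card_of_nodup
    (by convert hnodup), IsAlgClosed.card_aroots_eq_natDegree]

/-- Simplicity makes the number of distinct zeros the degree, and `|1/r| < 1 < |r|` makes the
removed pair distinct. -/
theorem ncard_onCircle {P : ℝ[X]} (h : ∀ z ∈ P.rootSet ℂ, zeroMult P z = 1) {r : ℝ}
    (hr : 1 < |r|)
    (hoff : {z ∈ P.rootSet ℂ | ‖z‖ ≠ 1} = {(r : ℂ), ((1 / r : ℝ) : ℂ)}) :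
    {z ∈ P.rootSet ℂ | ‖z‖ = 1}.ncard = P.natDegree - 2 := by
  have hne : (r : ℂ) ≠ ((1 / r : ℝ) : ℂ) := by
    intro heq
    have h1 : r = 1 / r := by exact_mod_cast heq
    have h2 : |1 / r| < 1 := by
      rw [abs_div, abs_one]
      exact (div_lt_one (one_pos.trans hr)).2 hr
    rw [← h1] at h2
    exact absurd h2 hr.not_gt
  have hdiff : {z ∈ P.rootSet ℂ | ‖z‖ = 1} = P.rootSet ℂ \ {z ∈ P.rootSet ℂ | ‖z‖ ≠ 1} := by
    ext z
    simp only [Set.mem_sep_iff, Set.mem_sdiff]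
    tauto
  rw [hdiff, Set.ncard_sdiff (Set.sep_subset _ _) ((rootSet_finite P ℂ).subset (Set.sep_subset _ _)),
    ncard_rootSet_of_zeroMult_eq_one h, hoff, Set.ncard_pair hne]

/-! ### Effect of the factor `z + 1` -/

section OddVersion

variable {P : ℝ[X]} {s : ℝ}

/-- All claims on `S` reduce to `P` through this: the extra zero lies on the circle and changes the
multiplicity only at `-1`. -/
theorem aroots_oddVersion (hP : P ≠ 0) (hs : s ≠ 0) :
    (oddVersion s P).aroots ℂ = -1 ::ₘ P.aroots ℂ := by
  have hX : (X + 1 : ℝ[X]) = X - C (-1) := by simp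
  have hX0 : (X + 1 : ℝ[X]) ≠ 0 := by rw [hX]; exact X_sub_C_ne_zero _
  rw [oddVersion, aroots_C_mul _ hs, aroots_mul (mul_ne_zero hX0 hP), hX, aroots_X_sub_C,
    Multiset.singleton_add]
  simp

theorem rootSet_oddVersion (hP : P ≠ 0) (hs : s ≠ 0) :
    (oddVersion s P).rootSet ℂ = insert (-1) (P.rootSet ℂ) := by
  ext z
  rw [mem_rootSet_iff_mem_aroots, aroots_oddVersion hP hs, Multiset.mem_cons, Set.mem_insert_iff,
    mem_rootSet_iff_mem_aroots]

theorem zeroMult_oddVersion_neg_one (hP : P ≠ 0) (hs : s ≠ 0) :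
    zeroMult (oddVersion s P) (-1) = zeroMult P (-1) + 1 := by
  classical
  rw [zeroMult_eq_count, aroots_oddVersion hP hs, Multiset.count_cons_self, zeroMult_eq_count]

theorem zeroMult_oddVersion_of_ne (hP : P ≠ 0) (hs : s ≠ 0) {z : ℂ} (hz : z ≠ -1) :
    zeroMult (oddVersion s P) z = zeroMult P z := by
  classical
  rw [zeroMult_eq_count, aroots_oddVersion hP hs, Multiset.count_cons_of_ne hz, zeroMult_eq_count]

theorem offCircleCount_oddVersion (hP : P ≠ 0) (hs : s ≠ 0) :
    offCircleCount (oddVersion s P) = offCircleCount P := by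
  rw [offCircleCount_eq_countP, aroots_oddVersion hP hs, Multiset.countP_cons_of_neg _ (by simp),
    offCircleCount_eq_countP]

theorem offCircle_oddVersion (hP : P ≠ 0) (hs : s ≠ 0) :
    {z ∈ (oddVersion s P).rootSet ℂ | ‖z‖ ≠ 1} = {z ∈ P.rootSet ℂ | ‖z‖ ≠ 1} := by
  ext z
  simp only [rootSet_oddVersion hP hs, Set.mem_sep_iff, Set.mem_insert_iff]
  constructor
  · rintro ⟨rfl | hz, h⟩
    · simp at h
    · exact ⟨hz, h⟩
  · rintro ⟨hz, h⟩
    exact ⟨Or.inr hz, h⟩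

theorem zeroMult_oddVersion_eq_one (hP : P ≠ 0) (hs : s ≠ 0) {z : ℂ}
    (hz : z ∈ (oddVersion s P).rootSet ℂ) (h1 : z = -1 → zeroMult P (-1) = 0)
    (h : z ∈ P.rootSet ℂ → zeroMult P z = 1) : zeroMult (oddVersion s P) z = 1 := by
  rw [rootSet_oddVersion hP hs, Set.mem_insert_iff] at hz
  by_cases hz1 : z = -1
  · rw [hz1, zeroMult_oddVersion_neg_one hP hs, h1 hz1]
  · rw [zeroMult_oddVersion_of_ne hP hs hz1, h (hz.resolve_left hz1)]

theorem natDegree_oddVersion (hP : P ≠ 0) (hs : s ≠ 0) :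
    (oddVersion s P).natDegree = P.natDegree + 1 := by
  have hX : (X + 1 : ℝ[X]) = X + C 1 := by simp
  rw [oddVersion, natDegree_C_mul hs, hX, natDegree_mul (X_add_C_ne_zero _) hP, natDegree_X_add_C,
    add_comm]

end OddVersion

/-! ### Case analysis in the parameter and the main theorem -/

/-- The data used for every value of the parameter: the zeros of `R` and the factorization of
`P`; at most one zero lies outside `(-1, 1)`, and its position is governed by the parameter. -/
theorem ChebKind.IsP.exists_factorization {α : ChebKind} {n : ℕ} (hn : 1 ≤ n) {P : ℝ[X]}
    (h : α.IsP n P) : ∃ (x : Fin n → ℝ) (b : ℝ) (k₀ : Fin n), Function.Injective x ∧ b ≠ 0 ∧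
      P = C b * ∏ k, reciprocalQuadratic (x k) ∧ (∀ k, k ≠ k₀ → x k ∈ Set.Ioo (-1 : ℝ) 1) ∧
      (α.param n P = α.ratio n 1 → x k₀ = 1) ∧ (α.ratio n 1 < α.param n P → 1 < x k₀) ∧
      (α.param n P = α.ratio n (-1) → x k₀ = -1) ∧
      (α.param n P < α.ratio n (-1) → x k₀ < -1) ∧
      (α.param n P ∈ Set.Ioo (α.ratio n (-1)) (α.ratio n 1) → x k₀ ∈ Set.Ioo (-1 : ℝ) 1) := by
  have hI := α.interlacing hn
  have hlt : α.ratio n (-1) < α.ratio n 1 := hI.ratio_neg_one_neg.trans hI.ratio_one_pos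
  rcases le_or_gt (α.ratio n 1) (α.param n P) with hc | hc
  · obtain ⟨x, hx, h0, k₀, hk, h1, h2⟩ := hI.exists_roots_of_ge hc
    obtain ⟨-, b, hb, hP⟩ := h.eq_prod hn hx h0
    exact ⟨x, b, k₀, hx, hb, hP, hk, h1, h2, fun h' => absurd h' (hlt.trans_le hc).ne',
      fun h' => absurd h' (hlt.trans_le hc).not_gt, fun h' => absurd h'.2 hc.not_gt⟩
  rcases le_or_gt (α.param n P) (α.ratio n (-1)) with hc' | hc'
  · obtain ⟨x, hx, h0, k₀, hk, h1, h2⟩ := hI.exists_roots_of_le hc'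
    obtain ⟨-, b, hb, hP⟩ := h.eq_prod hn hx h0
    exact ⟨x, b, k₀, hx, hb, hP, hk, fun h' => absurd h' hc.ne,
      fun h' => absurd h' hc.not_gt, h1, h2, fun h' => absurd h'.1 hc'.not_gt⟩
  · obtain ⟨θ, hθ, -⟩ := hI.exists_angles
    have hθc := hθ _ ⟨hc', hc⟩
    have hmem : ∀ k, Real.cos (θ (α.param n P) k) ∈ Set.Ioo (-1 : ℝ) 1 := fun k =>
      Interlacing.cos_mem_Ioo (hI.mem_Ioo_pi k.2 (hθc k).1).1 (hI.mem_Ioo_pi k.2 (hθc k).1).2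
    have hinj : Function.Injective fun k => Real.cos (θ (α.param n P) k) := fun i j hij =>
      Fin.ext (hI.cos_injective i.2 j.2 (hθc i).1 (hθc j).1 hij)
    obtain ⟨-, b, hb, hP⟩ := h.eq_prod hn hinj (fun k => (hθc k).2)
    -- All zeros lie inside here, so the distinguished index is arbitrary.
    exact ⟨_, b, ⟨0, hn⟩, hinj, hb, hP, fun k _ => hmem k, fun h' => absurd h' hc.ne,
      fun h' => absurd h' hc.not_gt, fun h' => absurd h' hc'.ne',
      fun h' => absurd h' hc'.not_gt, fun _ => hmem _⟩

/-- The zeros when a reciprocal pair of real zeros leaves the unit circle. -/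
theorem offCircle_and_ncard {n : ℕ} (hn : 1 ≤ n) {P : ℝ[X]} {s : ℝ} {x : Fin n → ℝ} {b : ℝ}
    {k₀ : Fin n} (hdeg : P.natDegree = 2 * n) (hs : s ≠ 0) (hx : Function.Injective x)
    (hb : b ≠ 0) (hP : P = C b * ∏ k, reciprocalQuadratic (x k))
    (hk : ∀ k, k ≠ k₀ → x k ∈ Set.Ioo (-1 : ℝ) 1) {r : ℝ} (hr : 1 < |r|)
    (hrx : r + 1 / r = 2 * x k₀) (h1 : ∀ k, x k ≠ 1) (h2 : ∀ k, x k ≠ -1) :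
    ({z ∈ P.rootSet ℂ | ‖z‖ ≠ 1} = {(r : ℂ), ((1 / r : ℝ) : ℂ)} ∧
      {z ∈ (oddVersion s P).rootSet ℂ | ‖z‖ ≠ 1} = {(r : ℂ), ((1 / r : ℝ) : ℂ)}) ∧
    {z ∈ P.rootSet ℂ | ‖z‖ = 1}.ncard = 2 * n - 2 ∧
    {z ∈ (oddVersion s P).rootSet ℂ | ‖z‖ = 1}.ncard = 2 * n - 1 := by
  have hP0 : P ≠ 0 := by
    rintro rfl
    rw [natDegree_zero] at hdeg
    omega
  have hoff := offCircle_eq_pair hb hP hk hr hrx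
  have hoff' := (offCircle_oddVersion hP0 hs).trans hoff
  have hsimple : ∀ z ∈ P.rootSet ℂ, zeroMult P z = 1 := fun z hz =>
    zeroMult_eq_one hb hP hx hz (fun k h => absurd h (h1 k)) (fun k h => absurd h (h2 k))
  have hsimple' : ∀ z ∈ (oddVersion s P).rootSet ℂ, zeroMult (oddVersion s P) z = 1 :=
    fun z hz => zeroMult_oddVersion_eq_one hP0 hs hz
      (fun _ => zeroMult_neg_one_eq_zero hb hP h2) (hsimple z)
  refine ⟨⟨hoff, hoff'⟩, ?_, ?_⟩
  · rw [ncard_onCircle hsimple hr hoff, hdeg]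
  · rw [ncard_onCircle hsimple' hr hoff', natDegree_oddVersion hP0 hs, hdeg]
    omega

theorem ChebKind.IsP.zeros {α : ChebKind} {n : ℕ} (hn : 1 ≤ n) {P : ℝ[X]} {s : ℝ}
    (h : α.IsP n P) (hs : s ≠ 0) :
    (α.param n P ≠ α.ratio n 1 → α.param n P ≠ α.ratio n (-1) →
      (∀ z ∈ P.rootSet ℂ, zeroMult P z = 1) ∧
      (∀ z ∈ (oddVersion s P).rootSet ℂ, zeroMult (oddVersion s P) z = 1)) ∧
    offCircleCount P ≤ 2 ∧ offCircleCount (oddVersion s P) ≤ 2 ∧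
    (α.param n P = α.ratio n 1 →
      zeroMult P 1 = 2 ∧ zeroMult (oddVersion s P) 1 = 2 ∧
      (∀ z ∈ P.rootSet ℂ, z ≠ 1 → zeroMult P z = 1) ∧
      (∀ z ∈ (oddVersion s P).rootSet ℂ, z ≠ 1 → zeroMult (oddVersion s P) z = 1)) ∧
    (α.param n P = α.ratio n (-1) →
      zeroMult P (-1) = 2 ∧ zeroMult (oddVersion s P) (-1) = 3 ∧
      (∀ z ∈ P.rootSet ℂ, z ≠ -1 → zeroMult P z = 1) ∧
      (∀ z ∈ (oddVersion s P).rootSet ℂ, z ≠ -1 → zeroMult (oddVersion s P) z = 1)) ∧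
    (α.param n P < α.ratio n (-1) →
      (∃ r : ℝ, r < -1 ∧ -1 < 1 / r ∧ 1 / r < 0 ∧
        {z ∈ P.rootSet ℂ | ‖z‖ ≠ 1} = {(r : ℂ), ((1 / r : ℝ) : ℂ)} ∧
        {z ∈ (oddVersion s P).rootSet ℂ | ‖z‖ ≠ 1} = {(r : ℂ), ((1 / r : ℝ) : ℂ)}) ∧
      {z ∈ P.rootSet ℂ | ‖z‖ = 1}.ncard = 2 * n - 2 ∧
      {z ∈ (oddVersion s P).rootSet ℂ | ‖z‖ = 1}.ncard = 2 * n - 1) ∧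
    (α.ratio n 1 < α.param n P →
      (∃ r : ℝ, 1 < r ∧ 0 < 1 / r ∧ 1 / r < 1 ∧
        {z ∈ P.rootSet ℂ | ‖z‖ ≠ 1} = {(r : ℂ), ((1 / r : ℝ) : ℂ)} ∧
        {z ∈ (oddVersion s P).rootSet ℂ | ‖z‖ ≠ 1} = {(r : ℂ), ((1 / r : ℝ) : ℂ)}) ∧
      {z ∈ P.rootSet ℂ | ‖z‖ = 1}.ncard = 2 * n - 2 ∧
      {z ∈ (oddVersion s P).rootSet ℂ | ‖z‖ = 1}.ncard = 2 * n - 1) := by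
  have hP0 := h.ne_zero hn
  obtain ⟨x, b, k₀, hx, hb, hP, hk, h1, h1', h2, h2', h3⟩ := h.exists_factorization hn
  -- Every `x k` with `k ≠ k₀` is strictly inside, so the position of `x k₀` alone decides each
  -- case.
  have hne : ∀ y : ℝ, y = 1 ∨ y = -1 → x k₀ ≠ y → ∀ k, x k ≠ y := by
    intro y hy hy0 k hky
    by_cases hkk : k = k₀
    · exact hy0 (hkk ▸ hky)
    · have := hk k hkk
      rw [hky] at this
      rcases hy with rfl | rfl
      · exact lt_irrefl _ this.2
      · exact lt_irrefl _ this.1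
  have hcount := offCircleCount_le_two hb hP hk
  refine ⟨fun hc1 hc2 => ?_, hcount, (offCircleCount_oddVersion hP0 hs).trans_le hcount,
    fun hc => ?_, fun hc => ?_, fun hc => ?_, fun hc => ?_⟩
  · have hk0 : x k₀ ≠ 1 ∧ x k₀ ≠ -1 := by
      rcases lt_or_gt_of_ne hc1 with hc1 | hc1
      · rcases lt_or_gt_of_ne hc2 with hc2 | hc2
        · have := h2' hc2
          exact ⟨by linarith, this.ne⟩
        · exact ⟨(h3 ⟨hc2, hc1⟩).2.ne, (h3 ⟨hc2, hc1⟩).1.ne'⟩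
      · have := h1' hc1
        exact ⟨this.ne', by linarith⟩
    have hone := hne 1 (Or.inl rfl) hk0.1
    have hneg := hne (-1) (Or.inr rfl) hk0.2
    have hsimple : ∀ z ∈ P.rootSet ℂ, zeroMult P z = 1 := fun z hz =>
      zeroMult_eq_one hb hP hx hz (fun k h => absurd h (hone k)) (fun k h => absurd h (hneg k))
    exact ⟨hsimple, fun z hz => zeroMult_oddVersion_eq_one hP0 hs hz
      (fun _ => zeroMult_neg_one_eq_zero hb hP hneg) (hsimple z)⟩
  · have hk0 := h1 hc
    have hneg := hne (-1) (Or.inr rfl) (by rw [hk0]; norm_num)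
    have htwo := zeroMult_one_eq_two hb hP hx hk0
    have hsimple : ∀ z ∈ P.rootSet ℂ, z ≠ 1 → zeroMult P z = 1 := fun z hz hz1 =>
      zeroMult_eq_one hb hP hx hz (fun _ _ => hz1) (fun k h => absurd h (hneg k))
    refine ⟨htwo, ?_, hsimple, fun z hz hz1 => zeroMult_oddVersion_eq_one hP0 hs hz
      (fun _ => zeroMult_neg_one_eq_zero hb hP hneg) (fun hz' => hsimple z hz' hz1)⟩
    rw [zeroMult_oddVersion_of_ne hP0 hs (by norm_num), htwo]
  · have hk0 := h2 hc
    have hone := hne 1 (Or.inl rfl) (by rw [hk0]; norm_num)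
    have htwo := zeroMult_neg_one_eq_two hb hP hx hk0
    have hsimple : ∀ z ∈ P.rootSet ℂ, z ≠ -1 → zeroMult P z = 1 := fun z hz hz1 =>
      zeroMult_eq_one hb hP hx hz (fun k h => absurd h (hone k)) (fun _ _ => hz1)
    refine ⟨htwo, ?_, hsimple, fun z hz hz1 => zeroMult_oddVersion_eq_one hP0 hs hz
      (fun h => absurd h hz1) (fun hz' => hsimple z hz' hz1)⟩
    rw [zeroMult_oddVersion_neg_one hP0 hs, htwo]
  · have hk0 := h2' hc
    obtain ⟨r, hr, hrx⟩ := exists_add_inv_of_lt_neg_one hk0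
    obtain ⟨hoff, hcard⟩ := offCircle_and_ncard hn h.natDegree_eq hs hx hb hP hk
      (by rw [abs_of_neg (by linarith)]; linarith) hrx (hne 1 (Or.inl rfl) (by linarith))
      (hne (-1) (Or.inr rfl) hk0.ne)
    have hr0 : r < 0 := by linarith
    refine ⟨⟨r, hr, ?_, one_div_neg.2 hr0, hoff⟩, hcard⟩
    rw [lt_div_iff_of_neg hr0]
    linarith
  · have hk0 := h1' hc
    obtain ⟨r, hr, hrx⟩ := exists_add_inv_of_one_lt hk0
    obtain ⟨hoff, hcard⟩ := offCircle_and_ncard hn h.natDegree_eq hs hx hb hP hk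
      (by rw [abs_of_pos (by linarith)]; linarith) hrx (hne 1 (Or.inl rfl) hk0.ne')
      (hne (-1) (Or.inr rfl) (by linarith))
    have hr0 : 0 < r := by linarith
    exact ⟨⟨r, hr, one_div_pos.2 hr0, (div_lt_one hr0).2 hr, hoff⟩, hcard⟩

theorem rootSet_C_mul_prod_X_sub_C {n : ℕ} {a : ℝ} (ha : a ≠ 0) (x : Fin n → ℝ) :
    (C a * ∏ k, (X - C (x k))).rootSet ℂ = {w : ℂ | ∃ k, w = (x k : ℂ)} := by
  have h0 : C a * ∏ k, (X - C (x k)) ≠ 0 :=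
    mul_ne_zero (C_ne_zero.2 ha) (Finset.prod_ne_zero_iff.2 fun k _ => X_sub_C_ne_zero _)
  ext w
  rw [mem_rootSet, and_iff_right h0, map_mul, aeval_C, map_prod, mul_eq_zero,
    or_iff_right (by simpa using ha), Finset.prod_eq_zero_iff]
  simp [sub_eq_zero]

theorem mainTheorem2 (α : ChebKind) (n : ℕ) (hn : 1 ≤ n) :
    -- the two end points have opposite signs
    (α.ratio n (-1) < 0 ∧ 0 < α.ratio n 1) ∧
    (∀ (P : ℝ[X]) (s : ℝ), α.IsP n P → s ≠ 0 →
      -- simplicity, and at most two zeros off the unit circle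
      (α.param n P ≠ α.ratio n 1 → α.param n P ≠ α.ratio n (-1) →
        (∀ z ∈ P.rootSet ℂ, zeroMult P z = 1) ∧
        (∀ z ∈ (oddVersion s P).rootSet ℂ, zeroMult (oddVersion s P) z = 1)) ∧
      offCircleCount P ≤ 2 ∧ offCircleCount (oddVersion s P) ≤ 2 ∧
      -- the exceptional values of the parameter
      (α.param n P = α.ratio n 1 →
        zeroMult P 1 = 2 ∧ zeroMult (oddVersion s P) 1 = 2 ∧
        (∀ z ∈ P.rootSet ℂ, z ≠ 1 → zeroMult P z = 1) ∧
        (∀ z ∈ (oddVersion s P).rootSet ℂ, z ≠ 1 → zeroMult (oddVersion s P) z = 1)) ∧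
      (α.param n P = α.ratio n (-1) →
        zeroMult P (-1) = 2 ∧ zeroMult (oddVersion s P) (-1) = 3 ∧
        (∀ z ∈ P.rootSet ℂ, z ≠ -1 → zeroMult P z = 1) ∧
        (∀ z ∈ (oddVersion s P).rootSet ℂ, z ≠ -1 → zeroMult (oddVersion s P) z = 1)) ∧
      -- a reciprocal pair of negative zeros
      (α.param n P < α.ratio n (-1) →
        (∃ r : ℝ, r < -1 ∧ -1 < 1 / r ∧ 1 / r < 0 ∧
          {z ∈ P.rootSet ℂ | ‖z‖ ≠ 1} = {(r : ℂ), ((1 / r : ℝ) : ℂ)} ∧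
          {z ∈ (oddVersion s P).rootSet ℂ | ‖z‖ ≠ 1} = {(r : ℂ), ((1 / r : ℝ) : ℂ)}) ∧
        {z ∈ P.rootSet ℂ | ‖z‖ = 1}.ncard = 2 * n - 2 ∧
        {z ∈ (oddVersion s P).rootSet ℂ | ‖z‖ = 1}.ncard = 2 * n - 1) ∧
      -- a reciprocal pair of positive zeros
      (α.ratio n 1 < α.param n P →
        (∃ r : ℝ, 1 < r ∧ 0 < 1 / r ∧ 1 / r < 1 ∧
          {z ∈ P.rootSet ℂ | ‖z‖ ≠ 1} = {(r : ℂ), ((1 / r : ℝ) : ℂ)} ∧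
          {z ∈ (oddVersion s P).rootSet ℂ | ‖z‖ ≠ 1} = {(r : ℂ), ((1 / r : ℝ) : ℂ)}) ∧
        {z ∈ P.rootSet ℂ | ‖z‖ = 1}.ncard = 2 * n - 2 ∧
        {z ∈ (oddVersion s P).rootSet ℂ | ‖z‖ = 1}.ncard = 2 * n - 1)) ∧
    -- the parameter inside the interval: `x c k` and `θ c k` depend only on `α`, `n`, `c`, `k`
    (∃ x θ : ℝ → Fin n → ℝ,
      (∀ c k, θ c k = Real.arccos (x c k)) ∧
      (∀ k, StrictAntiOn (fun c => θ c k) (Set.Ioo (α.ratio n (-1)) (α.ratio n 1))) ∧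
      (∀ (P : ℝ[X]) (s : ℝ), α.IsP n P → s ≠ 0 →
        α.param n P ∈ Set.Ioo (α.ratio n (-1)) (α.ratio n 1) →
        (∀ z ∈ P.rootSet ℂ, ‖z‖ = 1) ∧
        (∀ z ∈ (oddVersion s P).rootSet ℂ, ‖z‖ = 1) ∧
        (∀ k, x (α.param n P) k ∈ Set.Ioo (-1 : ℝ) 1) ∧
        (α.quasi n P).rootSet ℂ = {w : ℂ | ∃ k, w = (x (α.param n P) k : ℂ)} ∧
        StrictMono (θ (α.param n P)) ∧
        (∀ k, 0 < θ (α.param n P) k ∧ θ (α.param n P) k < Real.pi) ∧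
        P.rootSet ℂ = {z : ℂ | ∃ k,
          z = Complex.exp ((θ (α.param n P) k : ℂ) * Complex.I) ∨
          z = Complex.exp (-((θ (α.param n P) k : ℂ) * Complex.I))} ∧
        (oddVersion s P).rootSet ℂ = {z : ℂ | (∃ k,
          z = Complex.exp ((θ (α.param n P) k : ℂ) * Complex.I) ∨
          z = Complex.exp (-((θ (α.param n P) k : ℂ) * Complex.I))) ∨
          z = Complex.exp ((Real.pi : ℂ) * Complex.I)})) := by
  have hI := α.interlacing hn
  refine ⟨⟨hI.ratio_neg_one_neg, hI.ratio_one_pos⟩, fun P s hP hs => hP.zeros hn hs, ?_⟩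
  -- The angles are fixed as functions of `c` before any `P` appears; hence they depend only on the
  -- kind, `n` and `c`.
  obtain ⟨θ, hθ, hbd⟩ := hI.exists_angles
  refine ⟨fun c k => Real.cos (θ c k), θ,
    fun c k => (Real.arccos_cos (hbd c k).1 (hbd c k).2).symm,
    fun k c hc d hd hcd => hI.angle_lt hθ hc hd hcd k, fun P s h hs hc => ?_⟩
  have hP0 := h.ne_zero hn
  have hθc := hθ _ hc
  have hpi := fun k => hI.mem_Ioo_pi (Fin.is_lt k) (hθc k).1
  have hmem := fun k => Interlacing.cos_mem_Ioo (hpi k).1 (hpi k).2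
  have hinj : Function.Injective fun k => Real.cos (θ (α.param n P) k) := fun i j hij =>
    Fin.ext (hI.cos_injective i.2 j.2 (hθc i).1 (hθc j).1 hij)
  obtain ⟨⟨a, ha, hR⟩, b, hb, hP⟩ := h.eq_prod hn hinj (fun k => (hθc k).2)
  have hroots : P.rootSet ℂ = {z : ℂ | ∃ k,
      z = Complex.exp ((θ (α.param n P) k : ℂ) * Complex.I) ∨
      z = Complex.exp (-((θ (α.param n P) k : ℂ) * Complex.I))} := by
    ext z
    rw [mem_rootSet_iff_mem_aroots, mem_aroots_iff hb hP]
    simp [aroots_reciprocalQuadratic_cos]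
  have hcircle : ∀ z ∈ P.rootSet ℂ, ‖z‖ = 1 := by
    intro z hz
    obtain ⟨k, hk⟩ := (mem_aroots_iff hb hP).1 (mem_rootSet_iff_mem_aroots.1 hz)
    exact norm_eq_one_of_mem_aroots (hmem k).1.le (hmem k).2.le hk
  refine ⟨hcircle, ?_, hmem, ?_, fun i j hij => hI.lt_of_mem_Ioo hij j.2 (hθc i).1 (hθc j).1,
    hpi, hroots, ?_⟩
  · intro z hz
    rw [rootSet_oddVersion hP0 hs] at hz
    rcases hz with rfl | hz
    · simp
    · exact hcircle z hz
  · rw [hR]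
    exact rootSet_C_mul_prod_X_sub_C ha _
  · rw [rootSet_oddVersion hP0 hs, hroots, Complex.exp_pi_mul_I]
    ext z
    exact or_comm
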